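/- Let $n\ge 1$. Write elements of $\mathbb{Q}^n$ and $\mathbb{R}^n$ as row vectors (or as column vectors, by transposition), and let $\operatorname{sign}\gamma\in\{\pm1\}$ be the sign of $\det\gamma$ for $\gamma\in GL_n(\mathbb{Q})$. *Test functions.* $\mathcal{S}(\mathbb{Q}^n)$ is the group of functions $f:\mathbb{Q}^n\to\mathbb{Z}$ that are invariant under translation by $N\mathbb{Z}^n$ and supported in $N^{-1}\mathbb{Z}^n$ for some integer $N\ge1$. $\mathcal{S}(\mathbb{A}_f^n\setminus\{0\})$ is the group of locally constant, compactly supported functions $\mathbb{A}_f^n\setminus\{0\}\to\mathbb{Z}$, where $\mathbb{A}_f$ is the ring of finite adeles of $\mathbb{Q}$; such a function, extended by $0$ to $\mathbb{A}_f^n$, restricts to an element of $\mathcal{S}(\mathbb{Q}^n)$. $GL_n(\mathbb{Q})$ acts on the left on both by $(\gamma\cdot f)(x)=f(x\gamma)$. *Laurent series and distributions.* $\mathbb{C}((T_1,\dots,T_n))$ is the fraction field of $\mathbb{C}[[T_1,\dots,T_n]]$, with the left action $(\gamma\cdot h)(T)=h(T\gamma)$, $T=(T_1,\dots,T_n)$.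 For $X=\mathbb{Q}^n$ or $X=\mathbb{A}_f^n\setminus\{0\}$ put $\operatorname{Dist}(X)=\operatorname{Hom}(\mathcal{S}(X),\mathbb{C}((T_1,\dots,T_n)))$, with the right action $(\mu|_\gamma)(f)=\gamma^T\cdot\mu(\gamma\cdot f)$. *The Solomon–Hu pairing.* Let $\mathbb{R}^+=(0,\infty)$ and let $\mathcal{L}_{\mathbb{Q}^n}$ be the group of functions $\mathbb{R}^n\to\mathbb{Z}$ generated by the characteristic functions of the open rational cones $\mathbb{R}^+v_1+\dots+\mathbb{R}^+v_r$ ($r\ge0$, $v_j\in\mathbb{Q}^n$ linearly independent), modulo constant functions. The pairing $\langle\cdot,\cdot\rangle_{SH}:\mathcal{L}_{\mathbb{Q}^n}\times\mathcal{S}(\mathbb{Q}^n)\to\mathbb{C}((T_1,\dots,T_n))$ is the biadditive map with $$\langle\chi_{\mathbb{R}^+v_1+\dots+\mathbb{R}^+v_r},f\rangle_{SH}=\frac{1}{1-e^{v_1\cdot T}}\cdots\frac{1}{1-e^{v_r\cdot T}}\sum_{w\in\mathbb{Q}^n\cap((0,1]v_1+\dots+(0,1]v_r)}f(w)e^{w\cdot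 T}$$ whenever $v_1,\dots,v_r$ are linearly independent and $f$ is invariant under translation by each $v_j$. For $f\in\mathcal{S}(\mathbb{A}_f^n\setminus\{0\})$, $\langle c,f\rangle_{SH}$ is the pairing of $c$ with the restriction of $f$ to $\mathbb{Q}^n$. *The Shintani cocycle.* Let $\mathbb{F}=\mathbb{R}((\epsilon_1))\cdots((\epsilon_n))$, ordered so that a nonzero Laurent series in $\epsilon_k$ over $\mathbb{R}((\epsilon_1))\cdots((\epsilon_{k-1}))$ is positive iff its coefficient at the lowest power of $\epsilon_k$ is positive. Let $b(\epsilon)=(1,\epsilon,\dots,\epsilon^{n-1})^T$. For $\gamma_1,\dots,\gamma_n\in GL_n(\mathbb{Q})$ and $w\in\mathbb{R}^n$ let $\sigma_n^{Sh}(\gamma_1,\dots,\gamma_n)(w)$ be the sign of $\det(\gamma_1b(\epsilon_1),\dots,\gamma_nb(\epsilon_n))$ if $w=\sum_j\lambda_j\gamma_jb(\epsilon_j)$ with all $\lambda_j\in\mathbb{F}$ positive, and $0$ otherwise. This defines an element of $\mathcal{L}_{\mathbb{Q}^n}$, and $\Phi_n^{Sh}(\gamma_1,\dots,\gamma_n):=\langle\sigma_n^{Sh}(\gamma_1,\dots,\gamma_n),\cdot\rangle_{SH}\in\operatorname{Dist}(\mathbb{A}_f^n\setminus\{0\})$.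 The same formula also defines an element of $\operatorname{Dist}(\mathbb{Q}^n)$, denoted in the same way. *The Naive Shintani function.* With $e_1=(1,0,\dots,0)$, $\Phi_n^{NSh}(\gamma_1,\dots,\gamma_n)\in\operatorname{Dist}(\mathbb{Q}^n)$ is $f\mapsto\langle\chi_{\mathbb{R}^+e_1\gamma_1^T+\dots+\mathbb{R}^+e_1\gamma_n^T},f\rangle_{SH}$. **Proposition.** For all $\gamma,\gamma_1,\dots,\gamma_n\in GL_n(\mathbb{Q})$, $$\Phi_n^{Sh}(\gamma\gamma_1,\dots,\gamma\gamma_n)=(\operatorname{sign}\gamma)\,\Phi_n^{Sh}(\gamma_1,\dots,\gamma_n)|_{\gamma^T},$$ both in $\operatorname{Dist}(\mathbb{A}_f^n\setminus\{0\})$ and in $\operatorname{Dist}(\mathbb{Q}^n)$, and $$\Phi_n^{NSh}(\gamma\gamma_1,\dots,\gamma\gamma_n)=\Phi_n^{NSh}(\gamma_1,\dots,\gamma_n)|_{\gamma^T}.$$ -/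

import Mathlib

open scoped Matrix

namespace ShintaniCocycle

/-! ### Test functions on `ℚⁿ` -/

/-- `𝒮(ℚⁿ)`: the group of integer valued functions on `ℚⁿ` that are invariant under translation by
some lattice `N ℤⁿ` (locally constant) and supported in some lattice `N⁻¹ ℤⁿ` (bounded support). -/
def testFun (n : ℕ) : AddSubgroup ((Fin n → ℚ) → ℤ) where
  carrier := {f | ∃ N : ℕ, 0 < N ∧
    (∀ (x : Fin n → ℚ) (m : Fin n → ℤ), f (fun i => x i + N * m i) = f x) ∧
    (∀ x : Fin n → ℚ, f x ≠ 0 → ∃ m : Fin n → ℤ, ∀ i, N * x i = m i)}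
  zero_mem' := ⟨1, one_pos, fun _ _ => rfl, fun x hx => absurd rfl hx⟩
  neg_mem' := by
    rintro f ⟨N, hN, h1, h2⟩
    exact ⟨N, hN, fun x m => by simp [h1], fun x hx => h2 x (by simpa using hx)⟩
  add_mem' := by
    rintro f g ⟨N, hN, h1, h2⟩ ⟨M, hM, k1, k2⟩
    refine ⟨N * M, Nat.mul_pos hN hM, fun x m => ?_, fun x hx => ?_⟩
    · change f _ + g _ = f x + g x
      have e1 := h1 x (fun i => M * m i)
      have e2 := k1 x (fun i => N * m i)
      have a1 : (fun i => x i + (N : ℚ) * ((M * m i : ℤ) : ℚ)) =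
          fun i => x i + ((N * M : ℕ) : ℚ) * m i := by funext i; push_cast; ring
      have a2 : (fun i => x i + (M : ℚ) * ((N * m i : ℤ) : ℚ)) =
          fun i => x i + ((N * M : ℕ) : ℚ) * m i := by funext i; push_cast; ring
      rw [a1] at e1
      rw [a2] at e2
      rw [e1, e2]
    · by_cases hf : f x = 0
      · have hg : g x ≠ 0 := by simpa [hf] using hx
        obtain ⟨m, hm⟩ := k2 x hg
        exact ⟨fun i => N * m i, fun i => by push_cast; rw [← hm i]; ring⟩
      · obtain ⟨m, hm⟩ := h2 x hf
        exact ⟨fun i => M * m i, fun i => by push_cast; rw [← hm i]; ring⟩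

/-- A common denominator of finitely many rational numbers. -/
theorem exists_common_den {ι : Type*} [Finite ι] (q : ι → ℚ) :
    ∃ D : ℕ, 0 < D ∧ ∀ i, ∃ z : ℤ, (D : ℚ) * q i = z := by
  classical
  cases nonempty_fintype ι
  refine ⟨∏ i, (q i).den, Finset.prod_pos fun i _ => (q i).pos, fun i => ?_⟩
  obtain ⟨c, hc⟩ := Finset.dvd_prod_of_mem (fun j => (q j).den) (Finset.mem_univ i)
  refine ⟨c * (q i).num, ?_⟩
  rw [hc]
  push_cast
  rw [← Rat.mul_den_eq_num (q i)]
  ring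

/-- The left action of `GLₙ(ℚ)` on `𝒮(ℚⁿ)`: `(γ · f)(x) = f(x γ)`, with `x` a row vector. -/
def testFunAct {n : ℕ} (γ : GL (Fin n) ℚ) : testFun n →+ testFun n where
  toFun f := ⟨fun x => f.1 (x ᵥ* γ.1), by
    obtain ⟨f, N, hN, h1, h2⟩ := f
    obtain ⟨D, hD, hz⟩ := exists_common_den
      (fun p : (Fin n × Fin n) ⊕ (Fin n × Fin n) =>
        Sum.elim (fun p => γ.1 p.1 p.2) (fun p => (γ⁻¹).1 p.1 p.2) p)
    choose z hz using hz
    refine ⟨N * D, Nat.mul_pos hN hD, fun x m => ?_, fun x hx => ?_⟩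
    · simp only
      rw [← h1 (x ᵥ* γ.1) (fun j => ∑ i, m i * z (Sum.inl (i, j)))]
      congr 1
      funext j
      simp only [Matrix.vecMul, dotProduct, add_mul, Finset.sum_add_distrib]
      congr 1
      push_cast
      rw [Finset.mul_sum]
      apply Finset.sum_congr rfl
      intro i _
      rw [← hz]
      simp only [Sum.elim_inl]
      ring
    · obtain ⟨m, hm⟩ := h2 _ hx
      refine ⟨fun j => ∑ i, m i * z (Sum.inr (i, j)), fun j => ?_⟩
      have e : x = (x ᵥ* γ.1) ᵥ* (γ⁻¹).1 := by
        rw [Matrix.vecMul_vecMul, ← Units.val_mul, mul_inv_cancel]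
        simp
      conv_lhs => rw [e]
      simp only [Matrix.vecMul_eq_sum]
      push_cast
      rw [Finset.sum_apply, Finset.mul_sum]
      apply Finset.sum_congr rfl
      intro i _
      rw [← hz, ← hm i]
      simp [Matrix.vecMul, dotProduct]
      ring⟩
  map_zero' := rfl
  map_add' _ _ := rfl


/-! ### The field `ℂ((T₁, …, Tₙ))` -/

/-- `ℂ((T₁, …, Tₙ))`, the fraction field of `ℂ[[T₁, …, Tₙ]]`. -/
abbrev Laurent (n : ℕ) : Type := FractionRing (MvPowerSeries (Fin n) ℂ)

/-- The linear form `w · T = w₁ T₁ + ⋯ + wₙ Tₙ`. -/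
noncomputable def linForm {n : ℕ} (w : Fin n → ℚ) : MvPowerSeries (Fin n) ℂ :=
  ∑ i, (w i : ℂ) • MvPowerSeries.X i

/-- The power series `e^{w · T}`. -/
noncomputable def expT {n : ℕ} (w : Fin n → ℚ) : MvPowerSeries (Fin n) ℂ :=
  PowerSeries.subst (linForm w) (PowerSeries.exp ℂ)

theorem constantCoeff_linForm {n : ℕ} (w : Fin n → ℚ) :
    MvPowerSeries.constantCoeff (linForm w) = 0 := by
  simp [linForm]

theorem subst_exp_add {n : ℕ} {a b : MvPowerSeries (Fin n) ℂ}
    (ha : MvPowerSeries.constantCoeff a = 0) (hb : MvPowerSeries.constantCoeff b = 0) :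
    PowerSeries.subst (a + b) (PowerSeries.exp ℂ) =
      PowerSeries.subst a (PowerSeries.exp ℂ) * PowerSeries.subst b (PowerSeries.exp ℂ) := by
  have h2 : PowerSeries.subst (MvPowerSeries.X 0 + MvPowerSeries.X 1 : MvPowerSeries (Fin 2) ℂ)
      (PowerSeries.exp ℂ) = PowerSeries.subst (MvPowerSeries.X 0 : MvPowerSeries (Fin 2) ℂ)
      (PowerSeries.exp ℂ) * PowerSeries.subst (MvPowerSeries.X 1 : MvPowerSeries (Fin 2) ℂ)
      (PowerSeries.exp ℂ) := by
    ext e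
    rw [PowerSeries.coeff_subst_X_zero_add_X_one, PowerSeries.coeff_subst_X_zero_subst_mul_X_one]
    simp only [PowerSeries.coeff_exp, one_div, map_inv₀, map_natCast]
    rw [Nat.choose_eq_factorial_div_factorial (Nat.le_add_right _ _), Nat.add_sub_cancel_left]
    rw [Nat.cast_div (Nat.factorial_mul_factorial_dvd_factorial_add _ _)
      (by exact_mod_cast (Nat.mul_pos (Nat.factorial_pos _) (Nat.factorial_pos _)).ne')]
    have := Nat.factorial_ne_zero (e 0 + e 1)
    have := Nat.factorial_ne_zero (e 0)
    have := Nat.factorial_ne_zero (e 1)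
    push_cast
    field_simp
  have hs : MvPowerSeries.HasSubst (![a, b] : Fin 2 → MvPowerSeries (Fin n) ℂ) := by
    apply MvPowerSeries.hasSubst_of_constantCoeff_zero
    intro s
    fin_cases s
    · exact ha
    · exact hb
  have h3 := congrArg (MvPowerSeries.subst (![a, b] : Fin 2 → MvPowerSeries (Fin n) ℂ)) h2
  have e1 : ∀ c : MvPowerSeries (Fin 2) ℂ, MvPowerSeries.constantCoeff c = 0 →
      MvPowerSeries.subst (![a, b] : Fin 2 → MvPowerSeries (Fin n) ℂ)
        (PowerSeries.subst c (PowerSeries.exp ℂ)) =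
      PowerSeries.subst (MvPowerSeries.subst (![a, b] : Fin 2 → MvPowerSeries (Fin n) ℂ) c)
        (PowerSeries.exp ℂ) := fun c hc =>
    MvPowerSeries.subst_comp_subst_apply (PowerSeries.HasSubst.of_constantCoeff_zero hc).const hs _
  rw [MvPowerSeries.subst_mul hs, e1 _ (by simp), e1 _ (by simp), e1 _ (by simp),
    MvPowerSeries.subst_add hs, MvPowerSeries.subst_X hs, MvPowerSeries.subst_X hs] at h3
  simpa using h3

theorem expT_add {n : ℕ} (v w : Fin n → ℚ) : expT (v + w) = expT v * expT w := by
  unfold expT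
  rw [← subst_exp_add (constantCoeff_linForm v) (constantCoeff_linForm w)]
  congr 1
  simp [linForm, add_smul, Finset.sum_add_distrib]

theorem coeff_expT {n : ℕ} (w : Fin n → ℚ) (i : Fin n) :
    MvPowerSeries.coeff (Finsupp.single i 1) (expT w) = (w i : ℂ) := by
  classical
  unfold expT
  rw [PowerSeries.coeff_subst
    (PowerSeries.HasSubst.of_constantCoeff_zero (constantCoeff_linForm w)),
    finsum_eq_single _ 1]
  · simp [linForm, PowerSeries.coeff_exp, MvPowerSeries.coeff_X, Finsupp.single_left_inj]
  · intro d hd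
    rcases Nat.lt_or_gt_of_ne hd with h | h
    · have : d = 0 := by omega
      subst this
      simp [MvPowerSeries.coeff_one]
    · rw [MvPowerSeries.coeff_of_lt_order, smul_zero]
      refine lt_of_lt_of_le ?_
        (MvPowerSeries.le_order_pow_of_constantCoeff_eq_zero d (constantCoeff_linForm w))
      simpa using h

theorem one_sub_expT_ne_zero {n : ℕ} {v : Fin n → ℚ} (hv : v ≠ 0) :
    (1 : Laurent n) - algebraMap _ (Laurent n) (expT v) ≠ 0 := by
  classical
  intro h
  have h1 : (1 : MvPowerSeries (Fin n) ℂ) - expT v = 0 := by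
    apply IsFractionRing.injective (MvPowerSeries (Fin n) ℂ) (Laurent n)
    rw [map_sub, map_one, map_zero, h]
  apply hv
  funext i
  have := congrArg (MvPowerSeries.coeff (Finsupp.single i 1)) h1
  rw [map_sub, coeff_expT, MvPowerSeries.coeff_one] at this
  simpa using this

/-- The substitution `F(T) ↦ F(T γ)` of `ℂ[[T₁, …, Tₙ]]`, that is,
`T_j ↦ T · γ^{(j)} = ∑ i, γ i j • T_i` with `γ^{(j)}` the `j`-th column of `γ`. -/
noncomputable def substMat {n : ℕ} (γ : Matrix (Fin n) (Fin n) ℚ) :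
    MvPowerSeries (Fin n) ℂ →+* MvPowerSeries (Fin n) ℂ :=
  (MvPowerSeries.substAlgHom (R := ℂ) (a := fun j => linForm fun i => γ i j)
    (MvPowerSeries.hasSubst_of_constantCoeff_zero fun _ => constantCoeff_linForm _)).toRingHom

theorem substMat_substMat {n : ℕ} (γ δ : Matrix (Fin n) (Fin n) ℚ)
    (F : MvPowerSeries (Fin n) ℂ) : substMat γ (substMat δ F) = substMat (γ * δ) F := by
  unfold substMat
  simp only [AlgHom.toRingHom_eq_coe, RingHom.coe_coe]
  rw [MvPowerSeries.substAlgHom_comp_substAlgHom_apply, MvPowerSeries.substAlgHom_apply,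
    MvPowerSeries.substAlgHom_apply]
  congr 1
  funext j
  conv_lhs => rw [linForm, map_sum]
  simp only [map_smul, MvPowerSeries.substAlgHom_X]
  simp only [linForm, Finset.smul_sum, smul_smul, Matrix.mul_apply, Rat.cast_sum, Rat.cast_mul,
    Finset.sum_smul]
  rw [Finset.sum_comm]
  simp only [mul_comm]

theorem substMat_one {n : ℕ} (F : MvPowerSeries (Fin n) ℂ) : substMat 1 F = F := by
  classical
  unfold substMat
  simp only [AlgHom.toRingHom_eq_coe, RingHom.coe_coe]
  rw [MvPowerSeries.substAlgHom_apply]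
  have : (fun j : Fin n => linForm fun i => (1 : Matrix (Fin n) (Fin n) ℚ) i j) =
      MvPowerSeries.X := by
    funext j
    simp [linForm, Matrix.one_apply, apply_ite, ite_smul]
  rw [this, MvPowerSeries.subst_self]
  rfl

/-- The substitution `F(T) ↦ F(T γ)` for `γ ∈ GLₙ(ℚ)`, as an automorphism of
`ℂ[[T₁, …, Tₙ]]`. -/
noncomputable def substGL {n : ℕ} (γ : GL (Fin n) ℚ) :
    MvPowerSeries (Fin n) ℂ ≃+* MvPowerSeries (Fin n) ℂ :=
  RingEquiv.ofRingHom (substMat γ.1) (substMat (γ⁻¹).1)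
    (by ext1 F; simp [substMat_substMat, substMat_one])
    (by ext1 F; simp [substMat_substMat, substMat_one])

/-- The left action of `GLₙ(ℚ)` on `ℂ((T₁, …, Tₙ))`: `(γ · h)(T) = h(T γ)`. -/
noncomputable def laurentAct {n : ℕ} (γ : GL (Fin n) ℚ) : Laurent n ≃+* Laurent n :=
  IsFractionRing.ringEquivOfRingEquiv (substGL γ)

/-! ### Formal sums `∑ w, g(w) e^{w · T}` -/

/-- The difference `(1 - [v]) g : x ↦ g(x) - g(x - v)`. -/
def diff {n : ℕ} (v : Fin n → ℚ) (g : (Fin n → ℚ) → ℤ) : (Fin n → ℚ) → ℤ :=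
  fun x => g x - g (x - v)

/-- `(1 - [v₁]) ⋯ (1 - [v_r]) g`. -/
def diffs {n : ℕ} (l : List (Fin n → ℚ)) (g : (Fin n → ℚ) → ℤ) : (Fin n → ℚ) → ℤ :=
  l.foldr diff g

/-- The finite sum `∑ w, P(w) e^{w · T}`, for `P` of finite support. -/
noncomputable def expSum {n : ℕ} (P : (Fin n → ℚ) → ℤ) : Laurent n :=
  ∑ᶠ w, (P w : Laurent n) * algebraMap _ (Laurent n) (expT w)

/-- `∏ (1 - e^{v · T})` over the entries `v` of a list. -/
noncomputable def denom {n : ℕ} (l : List (Fin n → ℚ)) : Laurent n :=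
  (l.map fun v => 1 - algebraMap _ (Laurent n) (expT v)).prod

/-- `h` is the value of the formal sum `∑ w, g(w) e^{w · T}`: for some nonzero `v₁, …, v_r`,
multiplying the sum by `∏ (1 - e^{v_j · T})` gives a finite sum, whose value is
`h ∏ (1 - e^{v_j · T})`. -/
def IsFormalSum {n : ℕ} (g : (Fin n → ℚ) → ℤ) (h : Laurent n) : Prop :=
  ∃ l : List (Fin n → ℚ), (∀ v ∈ l, v ≠ 0) ∧ (Function.support (diffs l g)).Finite ∧
    h * denom l = expSum (diffs l g)

theorem diff_add {n : ℕ} (v : Fin n → ℚ) (g g' : (Fin n → ℚ) → ℤ) :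
    diff v (g + g') = diff v g + diff v g' := by
  funext x; simp only [diff, Pi.add_apply]; ring

theorem diff_comm {n : ℕ} (v w : Fin n → ℚ) (g : (Fin n → ℚ) → ℤ) :
    diff v (diff w g) = diff w (diff v g) := by
  funext x; simp only [diff, sub_right_comm x v w]; ring

theorem diffs_diff {n : ℕ} (l : List (Fin n → ℚ)) (v : Fin n → ℚ) (g : (Fin n → ℚ) → ℤ) :
    diffs l (diff v g) = diff v (diffs l g) := by
  induction l with
  | nil => rfl
  | cons w l ih =>
    change diff w (diffs l (diff v g)) = diff v (diff w (diffs l g))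
    rw [ih, diff_comm]

theorem diffs_append {n : ℕ} (l l' : List (Fin n → ℚ)) (g : (Fin n → ℚ) → ℤ) :
    diffs (l ++ l') g = diffs l (diffs l' g) := List.foldr_append

theorem diffs_comm {n : ℕ} (l l' : List (Fin n → ℚ)) (g : (Fin n → ℚ) → ℤ) :
    diffs l (diffs l' g) = diffs l' (diffs l g) := by
  induction l with
  | nil => rfl
  | cons v l ih =>
    change diff v (diffs l (diffs l' g)) = diffs l' (diff v (diffs l g))
    rw [ih, diffs_diff]

theorem diffs_add {n : ℕ} (l : List (Fin n → ℚ)) (g g' : (Fin n → ℚ) → ℤ) :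
    diffs l (g + g') = diffs l g + diffs l g' := by
  induction l with
  | nil => rfl
  | cons v l ih =>
    change diff v (diffs l (g + g')) = diff v (diffs l g) + diff v (diffs l g')
    rw [ih, diff_add]

theorem support_diff_finite {n : ℕ} (v : Fin n → ℚ) {g : (Fin n → ℚ) → ℤ}
    (hg : (Function.support g).Finite) : (Function.support (diff v g)).Finite := by
  refine (hg.union (hg.image fun x => x + v)).subset ?_
  intro x hx
  by_cases h : g x = 0
  · right
    refine ⟨x - v, ?_, by simp⟩
    intro h'
    exact hx (by simp [diff, h, h'])
  · exact Or.inl h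

theorem support_diffs_finite {n : ℕ} (l : List (Fin n → ℚ)) {g : (Fin n → ℚ) → ℤ}
    (hg : (Function.support g).Finite) : (Function.support (diffs l g)).Finite := by
  induction l with
  | nil => exact hg
  | cons v l ih => exact support_diff_finite v ih

theorem expSum_support {n : ℕ} {P : (Fin n → ℚ) → ℤ} (hP : (Function.support P).Finite) :
    (Function.support fun w =>
      (P w : Laurent n) * algebraMap _ (Laurent n) (expT w)).Finite := by
  refine hP.subset fun w hw h => hw ?_
  simp [h]

theorem expSum_add {n : ℕ} {P Q : (Fin n → ℚ) → ℤ} (hP : (Function.support P).Finite)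
    (hQ : (Function.support Q).Finite) : expSum (P + Q) = expSum P + expSum Q := by
  unfold expSum
  rw [← finsum_add_distrib (expSum_support hP) (expSum_support hQ)]
  apply finsum_congr
  intro w
  push_cast [Pi.add_apply]
  ring

theorem expSum_diff {n : ℕ} (v : Fin n → ℚ) {P : (Fin n → ℚ) → ℤ}
    (hP : (Function.support P).Finite) :
    expSum (diff v P) = expSum P * (1 - algebraMap _ (Laurent n) (expT v)) := by
  have hs : (Function.support fun x => P (x - v)).Finite := by
    refine (hP.image fun x => x + v).subset fun x hx => ⟨x - v, hx, by simp⟩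
  have e : expSum (fun x => P (x - v)) = expSum P * algebraMap _ (Laurent n) (expT v) := by
    unfold expSum
    rw [← finsum_comp_equiv (Equiv.addRight v), finsum_mul' _ _ (expSum_support hP)]
    apply finsum_congr
    intro w
    simp only [Equiv.coe_addRight, add_sub_cancel_right, expT_add, map_mul]
    ring
  have e2 : P = diff v P + fun x => P (x - v) := by
    funext x; simp [diff]
  have e3 := expSum_add (support_diff_finite v hP) hs
  rw [← e2, e] at e3
  linear_combination -e3

theorem expSum_diffs {n : ℕ} (l : List (Fin n → ℚ)) {P : (Fin n → ℚ) → ℤ}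
    (hP : (Function.support P).Finite) : expSum (diffs l P) = expSum P * denom l := by
  induction l with
  | nil => simp [diffs, denom]
  | cons v l ih =>
    change expSum (diff v (diffs l P)) = _
    rw [expSum_diff v (support_diffs_finite l hP), ih]
    simp only [denom, List.map_cons, List.prod_cons]
    ring

theorem denom_ne_zero {n : ℕ} {l : List (Fin n → ℚ)} (hl : ∀ v ∈ l, v ≠ 0) : denom l ≠ 0 := by
  unfold denom
  apply List.prod_ne_zero
  intro h
  obtain ⟨v, hv, h0⟩ := List.mem_map.1 h
  exact one_sub_expT_ne_zero (hl v hv) h0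

theorem denom_append {n : ℕ} (l l' : List (Fin n → ℚ)) :
    denom (l ++ l') = denom l * denom l' := by
  simp [denom]

theorem IsFormalSum.unique {n : ℕ} {g : (Fin n → ℚ) → ℤ} {h h' : Laurent n}
    (H : IsFormalSum g h) (H' : IsFormalSum g h') : h = h' := by
  obtain ⟨l, hl, hs, e⟩ := H
  obtain ⟨l', hl', hs', e'⟩ := H'
  have h1 := expSum_diffs l' hs
  have h2 := expSum_diffs l hs'
  rw [diffs_comm, h2, ← e, ← e'] at h1
  have h3 : denom l * denom l' ≠ 0 := mul_ne_zero (denom_ne_zero hl) (denom_ne_zero hl')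
  apply mul_right_cancel₀ h3
  linear_combination -h1

theorem IsFormalSum.add {n : ℕ} {g g' : (Fin n → ℚ) → ℤ} {h h' : Laurent n}
    (H : IsFormalSum g h) (H' : IsFormalSum g' h') : IsFormalSum (g + g') (h + h') := by
  obtain ⟨l, hl, hs, e⟩ := H
  obtain ⟨l', hl', hs', e'⟩ := H'
  refine ⟨l ++ l', fun v hv => (List.mem_append.1 hv).elim (hl v) (hl' v), ?_, ?_⟩
  · rw [diffs_add, diffs_append, diffs_append, diffs_comm]
    exact ((support_diffs_finite l' hs).union (support_diffs_finite l hs')).subset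
      (Function.support_add _ _)
  · rw [diffs_add, diffs_append, diffs_append, diffs_comm l l' g,
      expSum_add (support_diffs_finite l' hs) (support_diffs_finite l hs'),
      expSum_diffs l' hs, expSum_diffs l hs', ← e, ← e', denom_append]
    ring

theorem IsFormalSum.zero {n : ℕ} : IsFormalSum (0 : (Fin n → ℚ) → ℤ) 0 :=
  ⟨[], by simp, by simp [diffs], by simp [diffs, expSum]⟩

theorem diffs_neg {n : ℕ} (l : List (Fin n → ℚ)) (g : (Fin n → ℚ) → ℤ) :
    diffs l (-g) = -diffs l g := by
  have h := diffs_add l g (-g)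
  have h0 : diffs l (0 : (Fin n → ℚ) → ℤ) = 0 := by
    have := diffs_add l (0 : (Fin n → ℚ) → ℤ) 0
    simpa using this
  rw [add_neg_cancel, h0] at h
  exact (neg_eq_of_add_eq_zero_right h.symm).symm

theorem IsFormalSum.neg {n : ℕ} {g : (Fin n → ℚ) → ℤ} {h : Laurent n}
    (H : IsFormalSum g h) : IsFormalSum (-g) (-h) := by
  obtain ⟨l, hl, hs, e⟩ := H
  refine ⟨l, hl, by rw [diffs_neg, Function.support_neg]; exact hs, ?_⟩
  rw [diffs_neg, neg_mul, e]
  unfold expSum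
  rw [← finsum_neg_distrib]
  apply finsum_congr
  intro w
  push_cast [Pi.neg_apply]
  ring

open Classical in
/-- The value of the formal sum `∑ w, g(w) e^{w · T}`. -/
noncomputable def formalSum {n : ℕ} (g : (Fin n → ℚ) → ℤ) : Laurent n :=
  if H : ∃ h, IsFormalSum g h then H.choose else 0

theorem IsFormalSum.formalSum_eq {n : ℕ} {g : (Fin n → ℚ) → ℤ} {h : Laurent n}
    (H : IsFormalSum g h) : formalSum g = h := by
  have H' : ∃ h, IsFormalSum g h := ⟨h, H⟩
  rw [formalSum, dif_pos H']
  exact H'.choose_spec.unique H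

/-! ### Cone functions -/

/-- The open rational cone `ℝ⁺ v₁ + ⋯ + ℝ⁺ v_r ⊆ ℝⁿ` on rational vectors `v₁, …, v_r`. -/
def openCone {n : ℕ} {ι : Type} [Fintype ι] (v : ι → Fin n → ℚ) : Set (Fin n → ℝ) :=
  {x | ∃ t : ι → ℝ, (∀ j, 0 < t j) ∧ ∀ i, x i = ∑ j, t j * (v j i : ℝ)}

/-- The group of cone functions: the functions `ℝⁿ → ℤ` generated by the characteristic functions
of the open cones `ℝ⁺ v₁ + ⋯ + ℝ⁺ v_r` on linearly independent rational vectors (`r ≥ 0`). -/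
def coneGroup (n : ℕ) : AddSubgroup ((Fin n → ℝ) → ℤ) :=
  AddSubgroup.closure {c | ∃ (r : ℕ) (v : Fin r → Fin n → ℚ),
    LinearIndependent ℚ v ∧ c = (openCone v).indicator 1}
theorem exists_dual {n : ℕ} {ι : Type} [Fintype ι] [DecidableEq ι] {v : ι → Fin n → ℚ}
    (hv : LinearIndependent ℚ v) :
    ∃ p : ι → Fin n → ℚ, ∀ i j, ∑ k, p i k * v j k = if i = j then 1 else 0 := by
  obtain ⟨φ, hφ⟩ := LinearMap.exists_leftInverse_of_injective
    (Fintype.linearCombination ℚ v)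
    (LinearMap.ker_eq_bot.2 (linearIndependent_iff_injective_fintypeLinearCombination.1 hv))
  refine ⟨fun i k => φ (Pi.single k 1) i, fun i j => ?_⟩
  have h1 := congrArg (fun f => f (Pi.single j 1) i) hφ
  simp only [LinearMap.comp_apply, LinearMap.id_apply] at h1
  rw [Fintype.linearCombination_apply_single, one_smul] at h1
  have h2 : v j = ∑ k, v j k • (Pi.single k 1 : Fin n → ℚ) := by
    funext a
    simp [Finset.sum_apply, Pi.single_apply]
  rw [h2, map_sum] at h1
  simp only [map_smul, Finset.sum_apply, Pi.smul_apply, smul_eq_mul] at h1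
  rw [Pi.single_apply] at h1
  rw [← h1]
  exact Finset.sum_congr rfl fun k _ => mul_comm _ _

/-- The linear functional `x ↦ q · x` on `ℝⁿ` for a rational vector `q`. -/
def ratDot {n : ℕ} (q : Fin n → ℚ) (x : Fin n → ℝ) : ℝ := ∑ k, (q k : ℝ) * x k

theorem ratDot_sum {n : ℕ} {ι : Type} [Fintype ι] {v : ι → Fin n → ℚ} (q : Fin n → ℚ)
    {x : Fin n → ℝ} {t : ι → ℝ} (hx : ∀ i, x i = ∑ j, t j * (v j i : ℝ)) :
    ratDot q x = ∑ j, t j * ((∑ k, q k * v j k : ℚ) : ℝ) := by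
  unfold ratDot
  simp only [hx, Finset.mul_sum]
  rw [Finset.sum_comm]
  refine Finset.sum_congr rfl fun j _ => ?_
  push_cast
  rw [Finset.mul_sum]
  exact Finset.sum_congr rfl fun k _ => by ring

theorem ratDot_dual {n : ℕ} {ι : Type} [Fintype ι] [DecidableEq ι] {v p : ι → Fin n → ℚ}
    (hp : ∀ i j, ∑ k, p i k * v j k = if i = j then 1 else 0)
    {x : Fin n → ℝ} {t : ι → ℝ} (hx : ∀ i, x i = ∑ j, t j * (v j i : ℝ)) (i : ι) :
    ratDot (p i) x = t i := by
  rw [ratDot_sum _ hx]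
  simp [hp, apply_ite]

theorem openCone_reindex {n : ℕ} {ι κ : Type} [Fintype ι] [Fintype κ] (e : κ ≃ ι)
    (v : ι → Fin n → ℚ) : openCone (v ∘ e) = openCone v := by
  ext x
  constructor
  · rintro ⟨t, ht, hx⟩
    refine ⟨t ∘ e.symm, fun j => ht _, fun i => ?_⟩
    rw [hx, ← e.sum_comp]
    simp
  · rintro ⟨t, ht, hx⟩
    refine ⟨t ∘ e, fun j => ht _, fun i => ?_⟩
    rw [hx, ← e.sum_comp]
    simp

theorem openCone_mem {n : ℕ} {ι : Type} [Fintype ι] {v : ι → Fin n → ℚ}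
    (hv : LinearIndependent ℚ v) :
    (openCone v).indicator (1 : (Fin n → ℝ) → ℤ) ∈ coneGroup n := by
  refine AddSubgroup.subset_closure ⟨Fintype.card ι, v ∘ (Fintype.equivFin ι).symm,
    hv.comp _ (Equiv.injective _), ?_⟩
  rw [openCone_reindex]

theorem openCone_subtype {n : ℕ} {ι : Type} [Fintype ι] (p : ι → Prop)
    [Fintype {k // p k}] (w : ι → Fin n → ℚ) (x : Fin n → ℝ) :
    x ∈ openCone (fun k : {k // p k} => w k.1) ↔
      ∃ t : ι → ℝ, (∀ k, p k → 0 < t k) ∧ (∀ k, ¬ p k → t k = 0) ∧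
        ∀ i, x i = ∑ k, t k * (w k i : ℝ) := by
  classical
  have key : ∀ (t : ι → ℝ), (∀ k, ¬ p k → t k = 0) → ∀ i,
      ∑ k, t k * (w k i : ℝ) = ∑ k : {k // p k}, t k.1 * (w k.1 i : ℝ) := by
    intro t ht i
    rw [← Finset.sum_filter_add_sum_filter_not Finset.univ p]
    rw [Finset.sum_subtype (p := p) (Finset.univ.filter p) (by simp)]
    rw [Finset.sum_eq_zero (s := Finset.univ.filter fun k => ¬ p k), add_zero]
    intro k hk
    rw [ht k (by simpa using hk), zero_mul]
  constructor
  · rintro ⟨t, ht, hx⟩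
    have hk : ∀ k, ¬ p k → (if h : p k then t ⟨k, h⟩ else 0) = 0 := fun k h => dif_neg h
    refine ⟨fun k => if h : p k then t ⟨k, h⟩ else 0, fun k h => ?_, hk, fun i => ?_⟩
    · simp only [dif_pos h]; exact ht _
    · rw [key _ hk, hx]
      refine Finset.sum_congr rfl fun k _ => ?_
      simp only [dif_pos k.2]
  · rintro ⟨t, ht, h0, hx⟩
    exact ⟨fun k => t k.1, fun k => ht _ k.2, fun i => by rw [hx, key t h0]⟩

theorem sum_update {n : ℕ} {ι : Type} [Fintype ι] [DecidableEq ι] (v : ι → Fin n → ℚ) (j : ι)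
    (u : Fin n → ℚ) (t : ι → ℝ) (c : Fin n) :
    ∑ k, t k * (Function.update v j u k c : ℝ) =
      ∑ k, t k * (v k c : ℝ) + t j * ((u c : ℝ) - v j c) := by
  have : ∀ k, t k * (Function.update v j u k c : ℝ) =
      t k * (v k c : ℝ) + if k = j then t j * ((u c : ℝ) - v j c) else 0 := by
    intro k
    by_cases h : k = j
    · subst h; simp; ring
    · simp [h]
  simp only [this, Finset.sum_add_distrib]
  simp

theorem sum_update_coeff {n : ℕ} {ι : Type} [Fintype ι] [DecidableEq ι] (v : ι → Fin n → ℚ)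
    (j : ι) (s : ℝ) (t : ι → ℝ) (c : Fin n) :
    ∑ k, Function.update t j s k * (v k c : ℝ) =
      ∑ k, t k * (v k c : ℝ) + (s - t j) * v j c := by
  have : ∀ k, Function.update t j s k * (v k c : ℝ) =
      t k * (v k c : ℝ) + if k = j then (s - t j) * v j c else 0 := by
    intro k
    by_cases h : k = j
    · subst h; simp; ring
    · simp [h]
  simp only [this, Finset.sum_add_distrib]
  simp

/-- Subdivision of a simplicial cone along the ray through `v j + a v i`. -/
theorem openCone_split {n : ℕ} {ι : Type} [Fintype ι] [DecidableEq ι] {v : ι → Fin n → ℚ}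
    (hv : LinearIndependent ℚ v) {i j : ι} (hij : i ≠ j) {a : ℚ} (ha : 0 < a) :
    (openCone v).indicator (1 : (Fin n → ℝ) → ℤ) =
      (openCone (Function.update v j (v j + a • v i))).indicator 1 +
      (openCone (Function.update v i (v j + a • v i))).indicator 1 +
      (openCone fun k : {k // k ≠ i} => Function.update v j (v j + a • v i) k.1).indicator 1 := by
  obtain ⟨p, hp⟩ := exists_dual hv
  have ha' : (0 : ℝ) < a := by exact_mod_cast ha
  have hA : openCone (Function.update v j (v j + a • v i)) =
      {x | x ∈ openCone v ∧ a * ratDot (p j) x < ratDot (p i) x} := by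
    ext x
    constructor
    · rintro ⟨t, ht, hx⟩
      have hx' : ∀ c, x c = ∑ k, Function.update t i (t i + a * t j) k * (v k c : ℝ) := by
        intro c
        rw [hx, sum_update, sum_update_coeff]
        simp; ring
      refine ⟨⟨_, fun k => ?_, hx'⟩, ?_⟩
      · by_cases h : k = i
        · subst h; simp only [Function.update_self]; have := ht k; have := ht j; positivity
        · simp only [Function.update_of_ne h]; exact ht k
      · rw [ratDot_dual hp hx', ratDot_dual hp hx']
        simp only [Function.update_self, Function.update_of_ne hij.symm]
        linarith [ht i]
    · rintro ⟨⟨t, ht, hx⟩, h⟩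
      rw [ratDot_dual hp hx, ratDot_dual hp hx] at h
      refine ⟨Function.update t i (t i - a * t j), fun k => ?_, fun c => ?_⟩
      · by_cases h' : k = i
        · subst h'; simp only [Function.update_self]; linarith
        · simp only [Function.update_of_ne h']; exact ht k
      · rw [sum_update, sum_update_coeff, hx]
        simp [Function.update_of_ne hij.symm]; ring
  have hB : openCone (Function.update v i (v j + a • v i)) =
      {x | x ∈ openCone v ∧ ratDot (p i) x < a * ratDot (p j) x} := by
    ext x
    constructor
    · rintro ⟨t, ht, hx⟩
      have hx' : ∀ c, x c = ∑ k, Function.update (Function.update t i (a * t i)) j (t j + t i) k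
          * (v k c : ℝ) := by
        intro c
        rw [hx, sum_update, sum_update_coeff, sum_update_coeff]
        simp [Function.update_of_ne hij.symm]; ring
      refine ⟨⟨_, fun k => ?_, hx'⟩, ?_⟩
      · by_cases h : k = j
        · subst h; simp only [Function.update_self]; have := ht k; have := ht i; positivity
        · by_cases h' : k = i
          · subst h'
            simp only [Function.update_of_ne h, Function.update_self]
            have := ht k; positivity
          · simp only [Function.update_of_ne h, Function.update_of_ne h']; exact ht k
      · rw [ratDot_dual hp hx', ratDot_dual hp hx']
        simp only [Function.update_self, Function.update_of_ne hij]
        have := mul_pos ha' (ht j)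
        linarith
    · rintro ⟨⟨t, ht, hx⟩, h⟩
      rw [ratDot_dual hp hx, ratDot_dual hp hx] at h
      refine ⟨Function.update (Function.update t i (t i / a)) j (t j - t i / a),
        fun k => ?_, fun c => ?_⟩
      · by_cases h1 : k = j
        · subst h1; simp only [Function.update_self]
          rw [sub_pos, div_lt_iff₀ ha']; linarith
        · by_cases h' : k = i
          · subst h'
            simp only [Function.update_of_ne h1, Function.update_self]
            have := ht k; positivity
          · simp only [Function.update_of_ne h1, Function.update_of_ne h']; exact ht k
      · rw [sum_update, sum_update_coeff, sum_update_coeff, hx]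
        simp only [Function.update_of_ne hij, Function.update_self,
          Function.update_of_ne hij.symm, Pi.add_apply, Pi.smul_apply, smul_eq_mul]
        push_cast
        field_simp
        ring
  have hC : openCone (fun k : {k // k ≠ i} => Function.update v j (v j + a • v i) k.1) =
      {x | x ∈ openCone v ∧ ratDot (p i) x = a * ratDot (p j) x} := by
    ext x
    rw [openCone_subtype]
    constructor
    · rintro ⟨t, ht, h0, hx⟩
      have h0 := h0 i (by simp)
      have hx' : ∀ c, x c = ∑ k, Function.update t i (a * t j) k * (v k c : ℝ) := by
        intro c
        rw [hx, sum_update, sum_update_coeff, h0]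
        simp; ring
      refine ⟨⟨_, fun k => ?_, hx'⟩, ?_⟩
      · by_cases h : k = i
        · subst h; simp only [Function.update_self]; have := ht j hij.symm; positivity
        · simp only [Function.update_of_ne h]; exact ht k h
      · rw [ratDot_dual hp hx', ratDot_dual hp hx']
        simp only [Function.update_self, Function.update_of_ne hij.symm]
    · rintro ⟨⟨t, ht, hx⟩, h⟩
      rw [ratDot_dual hp hx, ratDot_dual hp hx] at h
      refine ⟨Function.update t i 0, fun k hk => ?_, fun k hk => ?_, fun c => ?_⟩
      · simp only [Function.update_of_ne hk]; exact ht k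
      · rw [not_not] at hk
        subst hk
        simp
      · rw [sum_update, sum_update_coeff, hx, h]
        simp [Function.update_of_ne hij.symm]; ring
  funext x
  simp only [Pi.add_apply, hA, hB, hC]
  by_cases hx : x ∈ openCone v
  · rcases lt_trichotomy (ratDot (p i) x) (a * ratDot (p j) x) with h | h | h
    · simp [hx, h, h.not_gt, h.ne]
    · simp [hx, h]
    · simp [hx, h, h.not_gt, h.ne']
  · simp [hx]

theorem halfspace_openCone {n : ℕ} (q : Fin n → ℚ) (m : ℕ) :
    ∀ {ι : Type} [Fintype ι] (v : ι → Fin n → ℚ), LinearIndependent ℚ v →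
    (Finset.univ.filter fun i => ∑ k, q k * v i k ≠ 0).card = m →
    (openCone v ∩ {x | 0 < ratDot q x}).indicator (1 : (Fin n → ℝ) → ℤ) ∈ coneGroup n ∧
    (openCone v ∩ {x | ratDot q x = 0}).indicator (1 : (Fin n → ℝ) → ℤ) ∈ coneGroup n := by
  classical
  induction m using Nat.strong_induction_on with
  | _ m ih =>
  intro ι _ v hv hm
  have hempty : ∀ S : Set (Fin n → ℝ), S = ∅ →
      S.indicator (1 : (Fin n → ℝ) → ℤ) ∈ coneGroup n := by
    rintro _ rfl
    rw [Set.indicator_empty]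
    exact zero_mem _
  have hfull : ∀ S : Set (Fin n → ℝ), S = openCone v →
      S.indicator (1 : (Fin n → ℝ) → ℤ) ∈ coneGroup n := by
    rintro _ rfl
    exact openCone_mem hv
  by_cases hpos : ∃ i, 0 < ∑ k, q k * v i k
  · obtain ⟨i, hi⟩ := hpos
    by_cases hneg : ∃ j, ∑ k, q k * v j k < 0
    · obtain ⟨j, hj⟩ := hneg
      have hij : i ≠ j := by rintro rfl; linarith
      set a : ℚ := -(∑ k, q k * v j k) / ∑ k, q k * v i k with ha_def
      have ha : 0 < a := div_pos (by linarith) hi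
      have hu : ∑ k, q k * (v j + a • v i) k = 0 := by
        have : ∑ k, q k * (v j + a • v i) k =
            ∑ k, q k * v j k + a * ∑ k, q k * v i k := by
          rw [Finset.mul_sum, ← Finset.sum_add_distrib]
          refine Finset.sum_congr rfl fun k _ => ?_
          simp; ring
        rw [this, ha_def]
        field_simp
        ring
      have hsplit := openCone_split hv hij ha
      have hl : (1 : ℚ) • (v j + a • v i) = Finsupp.linearCombination ℚ v
          (Finsupp.single j 1 + Finsupp.single i a) := by
        simp
      have hvA : LinearIndependent ℚ (Function.update v j (v j + a • v i)) :=
        hv.update j _ ⟨1, one_mem _, _, mem_nonZeroDivisors_of_ne_zero (by simp [hij]), hl⟩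
      have hvB : LinearIndependent ℚ (Function.update v i (v j + a • v i)) :=
        hv.update i _ ⟨1, one_mem _, _,
          mem_nonZeroDivisors_of_ne_zero (by simp [hij.symm, ha.ne']), hl⟩
      have hcard : ∀ l, ∑ k, q k * v l k ≠ 0 →
          (Finset.univ.filter fun x =>
            ∑ k, q k * Function.update v l (v j + a • v i) x k ≠ 0).card < m := by
        intro l hl
        rw [← hm]
        apply Finset.card_lt_card
        rw [Finset.ssubset_iff_of_subset]
        · exact ⟨l, by simpa using hl, by simpa using hu⟩
        · intro x hx
          by_cases hxl : x = l
          · subst hxl; simpa using hl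
          · simpa [Function.update_of_ne hxl] using hx
      have hA := ih _ (hcard j hj.ne) _ hvA rfl
      have hB := ih _ (hcard i hi.ne') _ hvB rfl
      have hcC : (Finset.univ.filter fun x : {k // k ≠ i} =>
            ∑ k, q k * Function.update v j (v j + a • v i) x.1 k ≠ 0).card < m := by
        refine lt_of_le_of_lt ?_ (hcard j hj.ne)
        rw [← Finset.card_map (Function.Embedding.subtype _)]
        apply Finset.card_le_card
        intro x hx
        simp only [Finset.mem_map, Finset.mem_filter, Finset.mem_univ, true_and] at hx ⊢
        obtain ⟨y, hy, rfl⟩ := hx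
        exact hy
      have hC := ih _ hcC (fun k : {k // k ≠ i} => Function.update v j (v j + a • v i) k.1)
        (hvA.comp _ Subtype.val_injective) rfl
      have key : ∀ Q : Set (Fin n → ℝ), (openCone v ∩ Q).indicator (1 : (Fin n → ℝ) → ℤ) =
          (openCone (Function.update v j (v j + a • v i)) ∩ Q).indicator 1 +
          (openCone (Function.update v i (v j + a • v i)) ∩ Q).indicator 1 +
          ((openCone fun k : {k // k ≠ i} => Function.update v j (v j + a • v i) k.1) ∩ Q).indicator
            1 := by
        intro Q
        simp only [Set.inter_indicator_one]
        rw [hsplit]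
        ring
      rw [key, key]
      exact ⟨add_mem (add_mem hA.1 hB.1) hC.1, add_mem (add_mem hA.2 hB.2) hC.2⟩
    · push Not at hneg
      have hp : ∀ x ∈ openCone v, 0 < ratDot q x := by
        rintro x ⟨t, ht, hx⟩
        rw [ratDot_sum _ hx]
        refine Finset.sum_pos' (fun l _ => mul_nonneg (ht l).le (by exact_mod_cast hneg l))
          ⟨i, Finset.mem_univ _, mul_pos (ht i) (by exact_mod_cast hi)⟩
      refine ⟨hfull _ (Set.inter_eq_left.2 hp), hempty _ ?_⟩
      ext x
      simp only [Set.mem_inter_iff, Set.mem_ofPred_eq, Set.mem_empty_iff_false, iff_false]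
      rintro ⟨h1, h2⟩
      exact (hp x h1).ne' h2
  · push Not at hpos
    have hp : ∀ x ∈ openCone v, ratDot q x ≤ 0 := by
      rintro x ⟨t, ht, hx⟩
      rw [ratDot_sum _ hx]
      exact Finset.sum_nonpos fun l _ =>
        mul_nonpos_of_nonneg_of_nonpos (ht l).le (by exact_mod_cast hpos l)
    refine ⟨hempty _ ?_, ?_⟩
    · ext x
      simp only [Set.mem_inter_iff, Set.mem_ofPred_eq, Set.mem_empty_iff_false, iff_false]
      rintro ⟨h1, h2⟩
      exact absurd h2 (hp x h1).not_gt
    · by_cases hneg : ∃ j, ∑ k, q k * v j k < 0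
      · obtain ⟨j, hj⟩ := hneg
        apply hempty
        ext x
        simp only [Set.mem_inter_iff, Set.mem_ofPred_eq, Set.mem_empty_iff_false, iff_false]
        rintro ⟨⟨t, ht, hx⟩, h2⟩
        rw [ratDot_sum _ hx] at h2
        have : ∑ l, t l * ((∑ k, q k * v l k : ℚ) : ℝ) < 0 :=
          Finset.sum_neg' (fun l _ =>
            mul_nonpos_of_nonneg_of_nonpos (ht l).le (by exact_mod_cast hpos l))
            ⟨j, Finset.mem_univ _, mul_neg_of_pos_of_neg (ht j) (by exact_mod_cast hj)⟩
        exact this.ne h2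
      · push Not at hneg
        apply hfull
        refine Set.inter_eq_left.2 ?_
        rintro x ⟨t, ht, hx⟩
        change ratDot q x = 0
        rw [ratDot_sum _ hx]
        apply Finset.sum_eq_zero
        intro l _
        rw [le_antisymm (hpos l) (hneg l)]
        simp
/-- Sets whose indicator function multiplies the group of cone functions into itself. -/
def IsConeSet {n : ℕ} (S : Set (Fin n → ℝ)) : Prop :=
  ∀ c ∈ coneGroup n, S.indicator (1 : (Fin n → ℝ) → ℤ) * c ∈ coneGroup n

theorem isConeSet_of_generators {n : ℕ} {S : Set (Fin n → ℝ)}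
    (h : ∀ (r : ℕ) (v : Fin r → Fin n → ℚ), LinearIndependent ℚ v →
      (openCone v ∩ S).indicator (1 : (Fin n → ℝ) → ℤ) ∈ coneGroup n) : IsConeSet S := by
  intro c hc
  refine AddSubgroup.closure_induction (p := fun c _ => S.indicator (1 : (Fin n → ℝ) → ℤ) * c
    ∈ coneGroup n) ?_ ?_ ?_ ?_ hc
  · rintro _ ⟨r, v, hv, rfl⟩
    rw [mul_comm, ← Set.inter_indicator_one]
    exact h r v hv
  · rw [mul_zero]; exact zero_mem _
  · intro x y _ _ hx hy
    rw [mul_add]; exact add_mem hx hy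
  · intro x _ hx
    rw [mul_neg]; exact neg_mem hx

theorem isConeSet_pos {n : ℕ} (q : Fin n → ℚ) : IsConeSet {x | 0 < ratDot q x} :=
  isConeSet_of_generators fun _ v hv => (halfspace_openCone q _ v hv rfl).1

theorem isConeSet_zero {n : ℕ} (q : Fin n → ℚ) : IsConeSet {x | ratDot q x = 0} :=
  isConeSet_of_generators fun _ v hv => (halfspace_openCone q _ v hv rfl).2

theorem IsConeSet.inter {n : ℕ} {S T : Set (Fin n → ℝ)} (hS : IsConeSet S) (hT : IsConeSet T) :
    IsConeSet (S ∩ T) := by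
  intro c hc
  rw [Set.inter_indicator_one, mul_assoc]
  exact hS _ (hT _ hc)

theorem IsConeSet.compl {n : ℕ} {S : Set (Fin n → ℝ)} (hS : IsConeSet S) : IsConeSet Sᶜ := by
  intro c hc
  rw [Set.indicator_compl, sub_mul]
  refine sub_mem ?_ (hS c hc)
  rw [one_mul]
  exact hc

theorem IsConeSet.union {n : ℕ} {S T : Set (Fin n → ℝ)} (hS : IsConeSet S) (hT : IsConeSet T) :
    IsConeSet (S ∪ T) := by
  have := (hS.compl.inter hT.compl).compl
  rwa [Set.compl_inter, compl_compl, compl_compl] at this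

theorem isConeSet_univ {n : ℕ} : IsConeSet (Set.univ : Set (Fin n → ℝ)) := by
  intro c hc
  rw [Set.indicator_univ, one_mul]
  exact hc

theorem isConeSet_empty {n : ℕ} : IsConeSet (∅ : Set (Fin n → ℝ)) := by
  have := (isConeSet_univ (n := n)).compl
  rwa [Set.compl_univ] at this

theorem isConeSet_iInter {n : ℕ} {ι : Type*} [Finite ι] {S : ι → Set (Fin n → ℝ)}
    (hS : ∀ i, IsConeSet (S i)) : IsConeSet (⋂ i, S i) := by
  classical
  cases nonempty_fintype ι
  have : ∀ s : Finset ι, IsConeSet (⋂ i ∈ s, S i) := by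
    intro s
    induction s using Finset.induction_on with
    | empty => simpa using isConeSet_univ
    | insert a s ha ih =>
      rw [Finset.set_biInter_insert]
      exact (hS a).inter ih
  simpa using this Finset.univ

theorem isConeSet_iUnion {n : ℕ} {ι : Type*} [Finite ι] {S : ι → Set (Fin n → ℝ)}
    (hS : ∀ i, IsConeSet (S i)) : IsConeSet (⋃ i, S i) := by
  have := (isConeSet_iInter fun i => (hS i).compl).compl
  rwa [Set.compl_iInter, Set.iUnion_congr fun i => compl_compl _] at this

/-- The constant function `1` is the sum of the indicators of the `3ⁿ` open orthant faces. -/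
theorem one_mem_coneGroup (n : ℕ) : (1 : (Fin n → ℝ) → ℤ) ∈ coneGroup n := by
  classical
  have hcell : ∀ s : Fin n → SignType,
      ({x : Fin n → ℝ | ∀ i, SignType.sign (x i) = s i}).indicator (1 : (Fin n → ℝ) → ℤ) ∈
        coneGroup n := by
    intro s
    have hLI : LinearIndependent ℚ (fun k : {k // s k ≠ 0} =>
        (Pi.single k.1 ((s k.1 : SignType) : ℚ) : Fin n → ℚ)) := by
      rw [Fintype.linearIndependent_iff]
      intro g hg k
      have := congrFun hg k.1
      rw [Finset.sum_apply, Finset.sum_eq_single k] at this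
      · have hk := k.2
        simp only [Pi.smul_apply, Pi.single_eq_same, smul_eq_mul, Pi.zero_apply] at this
        rcases mul_eq_zero.1 this with h | h
        · exact h
        · exfalso
          apply hk
          rcases hs : s k.1 with _ | _ | _ <;> simp_all
      · intro b _ hb
        have : k.1 ≠ b.1 := fun h => hb (Subtype.ext h.symm)
        simp [this]
      · simp
    have hset : {x : Fin n → ℝ | ∀ i, SignType.sign (x i) = s i} =
        openCone (fun k : {k // s k ≠ 0} =>
          (Pi.single k.1 ((s k.1 : SignType) : ℚ) : Fin n → ℚ)) := by
      ext x
      rw [openCone_subtype (p := fun k => s k ≠ 0)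
        (w := fun k => (Pi.single k ((s k : SignType) : ℚ) : Fin n → ℚ))]
      constructor
      · intro hx
        refine ⟨fun k => |x k|, fun k hk => ?_, fun k hk => ?_, fun i => ?_⟩
        · rw [abs_pos]
          rintro h
          apply hk
          rw [← hx k, h, sign_zero]
        · rw [not_not] at hk
          rw [← hx k, sign_eq_zero_iff] at hk
          simp [hk]
        · rw [Finset.sum_eq_single i]
          · rw [Pi.single_eq_same, ← hx i]
            rcases lt_trichotomy (x i) 0 with h | h | h
            · simp [sign_neg h, abs_of_neg h]
            · simp [h]
            · simp [sign_pos h, abs_of_pos h]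
          · intro k _ hk
            simp [hk.symm]
          · simp
      · rintro ⟨t, ht, h0, hx⟩ i
        have : x i = t i * ((s i : SignType) : ℚ) := by
          rw [hx, Finset.sum_eq_single i]
          · simp
          · intro k _ hk
            simp [hk.symm]
          · simp
        rw [this]
        by_cases hi : s i = 0
        · simp [hi]
        · have := ht i hi
          rw [sign_mul, sign_pos this, one_mul]
          rcases hs : s i with _ | _ | _ <;> simp_all
    rw [hset]
    exact openCone_mem hLI
  have : (1 : (Fin n → ℝ) → ℤ) = ∑ s : Fin n → SignType,
      ({x : Fin n → ℝ | ∀ i, SignType.sign (x i) = s i}).indicator 1 := by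
    funext x
    rw [Finset.sum_apply, Finset.sum_eq_single (fun i => SignType.sign (x i))]
    · simp
    · intro s _ hs
      rw [Set.indicator_of_notMem]
      intro h
      exact hs (funext fun i => (h i).symm)
    · simp
  rw [this]
  exact sum_mem fun s _ => hcell s

theorem IsConeSet.indicator_mem {n : ℕ} {S : Set (Fin n → ℝ)} (hS : IsConeSet S) :
    S.indicator (1 : (Fin n → ℝ) → ℤ) ∈ coneGroup n := by
  have := hS 1 (one_mem_coneGroup n)
  rwa [mul_one] at this

theorem isConeSet_openCone_of_linearIndependent {n : ℕ} {ι : Type} [Fintype ι]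
    {v : ι → Fin n → ℚ} (hv : LinearIndependent ℚ v) : IsConeSet (openCone v) := by
  classical
  obtain ⟨p, hp⟩ := exists_dual hv
  have : openCone v = (⋂ i, {x | 0 < ratDot (p i) x}) ∩
      ⋂ k : Fin n, {x | ratDot (fun l => (if l = k then 1 else 0) - ∑ i, v i k * p i l) x = 0} := by
    have hr : ∀ (k : Fin n) (x : Fin n → ℝ),
        ratDot (fun l => (if l = k then 1 else 0) - ∑ i, v i k * p i l) x =
          x k - ∑ i, ratDot (p i) x * (v i k : ℝ) := by
      intro k x
      simp only [ratDot, Finset.sum_mul]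
      rw [Finset.sum_comm]
      have : x k = ∑ l, (if l = k then (1 : ℝ) else 0) * x l := by simp
      conv_rhs => rw [this]
      rw [← Finset.sum_sub_distrib]
      refine Finset.sum_congr rfl fun l _ => ?_
      push_cast
      rw [sub_mul, Finset.sum_mul]
      congr 1
      · split_ifs <;> simp
      · exact Finset.sum_congr rfl fun i _ => by ring
    ext x
    simp only [Set.mem_inter_iff, Set.mem_iInter, Set.mem_ofPred_eq, hr, sub_eq_zero]
    constructor
    · rintro ⟨t, ht, hx⟩
      refine ⟨fun i => by rw [ratDot_dual hp hx]; exact ht i, fun k => ?_⟩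
      rw [hx]
      exact Finset.sum_congr rfl fun i _ => by rw [ratDot_dual hp hx]
    · rintro ⟨h1, h2⟩
      exact ⟨_, h1, h2⟩
  rw [this]
  exact (isConeSet_iInter fun i => isConeSet_pos _).inter
    (isConeSet_iInter fun k => isConeSet_zero _)

/-- Open cones on arbitrary (possibly linearly dependent) rational vectors are cone functions. -/
theorem isConeSet_openCone {n : ℕ} (m : ℕ) : ∀ {ι : Type} [Fintype ι] (v : ι → Fin n → ℚ),
    Fintype.card ι = m → IsConeSet (openCone v) := by
  classical
  induction m using Nat.strong_induction_on with
  | _ m ih =>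
  intro ι _ v hm
  by_cases hv : LinearIndependent ℚ v
  · exact isConeSet_openCone_of_linearIndependent hv
  · have hdep : ∃ a : ι → ℚ, (∀ c, ∑ k, a k * v k c = 0) ∧ ∃ k, 0 < a k := by
      rw [Fintype.not_linearIndependent_iff] at hv
      obtain ⟨g, hg, k, hk⟩ := hv
      have hg' : ∀ c, ∑ k, g k * v k c = 0 := fun c => by
        have := congrFun hg c
        simpa [Finset.sum_apply] using this
      rcases lt_or_gt_of_ne hk with h | h
      · exact ⟨fun k => -g k, fun c => by simp [hg' c], k, by simpa using h⟩
      · exact ⟨g, hg', k, h⟩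
    obtain ⟨a, ha, k0, hk0⟩ := hdep
    have hsum : ∀ (t : ι → ℝ) (s : ℝ) (c : Fin n),
        ∑ k, (t k + s * a k) * (v k c : ℝ) = ∑ k, t k * (v k c : ℝ) := by
      intro t s c
      have h0 : ∑ k, (a k : ℝ) * (v k c : ℝ) = 0 := by exact_mod_cast ha c
      simp only [add_mul, Finset.sum_add_distrib, mul_assoc]
      rw [← Finset.mul_sum, h0, mul_zero, add_zero]
    have hcover : openCone v = ⋃ I : {I : Finset ι // I.Nonempty ∧ ∀ k ∈ I, 0 < a k},
        openCone (fun k : {k // k ∉ I.1} => v k.1) := by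
      ext x
      rw [Set.mem_iUnion]
      constructor
      · rintro ⟨t, ht, hx⟩
        obtain ⟨k1, hk1, hmin⟩ := Finset.exists_min_image
          (Finset.univ.filter fun k => 0 < a k) (fun k => t k / a k) ⟨k0, by simpa using hk0⟩
        simp only [Finset.mem_filter, Finset.mem_univ, true_and] at hk1 hmin
        have hk1' : (0 : ℝ) < a k1 := by exact_mod_cast hk1
        refine ⟨⟨Finset.univ.filter fun k => 0 < a k ∧ t k + (-(t k1 / a k1)) * a k = 0,
          ⟨k1, ?_⟩, ?_⟩, ?_⟩
        · simp only [Finset.mem_filter, Finset.mem_univ, true_and]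
          refine ⟨hk1, ?_⟩
          field_simp
          ring
        · intro k hk
          simp only [Finset.mem_filter, Finset.mem_univ, true_and] at hk
          exact hk.1
        · rw [openCone_subtype]
          refine ⟨fun k => t k + (-(t k1 / a k1)) * a k, fun k hk => ?_, fun k hk => ?_,
            fun i => ?_⟩
          · simp only [Finset.mem_filter, Finset.mem_univ, true_and, not_and] at hk
            by_cases hak : 0 < a k
            · have hak' : (0 : ℝ) < a k := by exact_mod_cast hak
              refine lt_of_le_of_ne ?_ (Ne.symm (hk hak))
              have := hmin k hak
              rw [le_div_iff₀ hak'] at this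
              linarith
            · have hak' : (a k : ℝ) ≤ 0 := by exact_mod_cast not_lt.1 hak
              have h1 := div_pos (ht k1) hk1'
              have h2 := mul_nonpos_of_nonneg_of_nonpos h1.le hak'
              have := ht k
              linarith
          · simp only [Finset.mem_filter, Finset.mem_univ, true_and, not_not] at hk
            exact hk.2
          · rw [hsum, hx]
      · rintro ⟨⟨I, hI, hIa⟩, hx⟩
        rw [openCone_subtype (p := fun k => k ∉ I)] at hx
        obtain ⟨t, ht, h0, hx⟩ := hx
        have hsmall : ∃ s : ℝ, 0 < s ∧ ∀ k, k ∉ I → 0 < t k + s * a k := by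
          by_cases hne : (Finset.univ.filter fun k => k ∉ I).Nonempty
          · obtain ⟨k1, hk1, hmin⟩ := Finset.exists_min_image _
              (fun k => t k / (1 + |(a k : ℝ)|)) hne
            simp only [Finset.mem_filter, Finset.mem_univ, true_and] at hk1 hmin
            have hp : ∀ k, (0 : ℝ) < 1 + |(a k : ℝ)| := fun k => by positivity
            refine ⟨t k1 / (1 + |(a k1 : ℝ)|), div_pos (ht k1 hk1) (hp k1), fun k hk => ?_⟩
            have h1 := hmin k hk
            rw [le_div_iff₀ (hp k)] at h1
            have h2 := div_pos (ht k1 hk1) (hp k1)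
            have h3 := neg_abs_le (a k : ℝ)
            nlinarith
          · refine ⟨1, one_pos, fun k hk => ?_⟩
            exact absurd ⟨k, by simpa using hk⟩ hne
        obtain ⟨s, hs, hs'⟩ := hsmall
        refine ⟨fun k => t k + s * a k, fun k => ?_, fun i => ?_⟩
        · change 0 < t k + s * a k
          by_cases hk : k ∈ I
          · rw [h0 k (by simpa using hk), zero_add]
            exact mul_pos hs (by exact_mod_cast hIa k hk)
          · exact hs' k hk
        · rw [hsum, hx]
    rw [hcover]
    apply isConeSet_iUnion
    rintro ⟨I, ⟨k1, hk1⟩, hI⟩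
    refine ih (Fintype.card {k // k ∉ I}) ?_ _ rfl
    rw [← hm]
    exact Fintype.card_subtype_lt (x := k1) (by simpa using hk1)

theorem openCone_mem_coneGroup {n : ℕ} {ι : Type} [Fintype ι] (v : ι → Fin n → ℚ) :
    (openCone v).indicator (1 : (Fin n → ℝ) → ℤ) ∈ coneGroup n :=
  (isConeSet_openCone _ v rfl).indicator_mem
/-! ### The Solomon–Hu pairing -/

/-- The points `∑ t_j v_j` with all `t_j > 0`, and `t_j ≤ 1` for `j ∈ s`. -/
def boxCone {n : ℕ} {ι : Type} [Fintype ι] (v : ι → Fin n → ℚ) (s : Finset ι) :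
    Set (Fin n → ℝ) :=
  {x | ∃ t : ι → ℝ, (∀ j, 0 < t j) ∧ (∀ j ∈ s, t j ≤ 1) ∧ ∀ i, x i = ∑ j, t j * (v j i : ℝ)}

/-- The rational points of the parallelepiped `(0,1] v₁ + ⋯ + (0,1] v_r`. -/
def parallelepipedPts {n : ℕ} {ι : Type} [Fintype ι] (v : ι → Fin n → ℚ) : Set (Fin n → ℚ) :=
  {w | ∃ t : ι → ℝ, (∀ j, 0 < t j ∧ t j ≤ 1) ∧ ∀ i, (w i : ℝ) = ∑ j, t j * (v j i : ℝ)}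

/-- The product `w ↦ c(w) f(w)` on `ℚⁿ` of a function `c` on `ℝⁿ` and a function `f` on `ℚⁿ`. -/
def coneMul {n : ℕ} (c : (Fin n → ℝ) → ℤ) (f : (Fin n → ℚ) → ℤ) : (Fin n → ℚ) → ℤ :=
  fun w => c (fun i => (w i : ℝ)) * f w

theorem diff_boxCone {n : ℕ} {ι : Type} [Fintype ι] [DecidableEq ι] {v : ι → Fin n → ℚ}
    (hv : LinearIndependent ℚ v) {f : (Fin n → ℚ) → ℤ} {j : ι} {s : Finset ι} (hj : j ∉ s)
    (hf : ∀ x, f (x + v j) = f x) :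
    diff (v j) (coneMul ((boxCone v s).indicator 1) f) =
      coneMul ((boxCone v (insert j s)).indicator 1) f := by
  obtain ⟨p, hp⟩ := exists_dual hv
  funext w
  have hfw : f (w - v j) = f w := by
    rw [← hf (w - v j), sub_add_cancel]
  simp only [diff, coneMul, hfw, ← sub_mul]
  congr 1
  have hcast : (fun i => (((w - v j) i : ℚ) : ℝ)) = fun i => (w i : ℝ) - v j i := by
    funext i; simp
  rw [hcast]
  have hsub : ∀ (t : ι → ℝ), (∀ i, (w i : ℝ) = ∑ k, t k * (v k i : ℝ)) →
      ∀ i, (w i : ℝ) - v j i = ∑ k, Function.update t j (t j - 1) k * (v k i : ℝ) := by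
    intro t ht i
    rw [sum_update_coeff, ht]
    ring
  by_cases hw : (fun i => (w i : ℝ)) ∈ boxCone v s
  · rw [Set.indicator_of_mem hw]
    obtain ⟨t, ht, hs, hx⟩ := hw
    by_cases h1 : t j ≤ 1
    · rw [Set.indicator_of_notMem, Set.indicator_of_mem]
      · simp
      · refine ⟨t, ht, fun k hk => ?_, hx⟩
        rcases Finset.mem_insert.1 hk with rfl | hk
        · exact h1
        · exact hs k hk
      · rintro ⟨t', ht', _, hx'⟩
        have e1 := ratDot_dual hp hx' j
        have e2 := ratDot_dual hp (hsub t hx) j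
        rw [e1] at e2
        have := ht' j
        rw [e2, Function.update_self] at this
        linarith
    · rw [Set.indicator_of_mem, Set.indicator_of_notMem]
      · simp
      · rintro ⟨t', ht', hs', hx'⟩
        apply h1
        rw [← ratDot_dual hp hx j, ratDot_dual hp hx' j]
        exact hs' j (Finset.mem_insert_self _ _)
      · refine ⟨_, fun k => ?_, fun k hk => ?_, hsub t hx⟩
        · by_cases h : k = j
          · subst h; rw [Function.update_self]; linarith
          · rw [Function.update_of_ne h]; exact ht k
        · have h : k ≠ j := fun h => hj (h ▸ hk)
          rw [Function.update_of_ne h]; exact hs k hk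
  · rw [Set.indicator_of_notMem hw, Set.indicator_of_notMem, Set.indicator_of_notMem]
    · simp
    · rintro ⟨t, ht, hs, hx⟩
      exact hw ⟨t, ht, fun k hk => hs k (Finset.mem_insert_of_mem hk), hx⟩
    · rintro ⟨t, ht, hs, hx⟩
      refine hw ⟨Function.update t j (t j + 1), fun k => ?_, fun k hk => ?_, fun i => ?_⟩
      · by_cases h : k = j
        · subst h; rw [Function.update_self]; linarith [ht k]
        · rw [Function.update_of_ne h]; exact ht k
      · have h : k ≠ j := fun h => hj (h ▸ hk)
        rw [Function.update_of_ne h]; exact hs k hk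
      · rw [sum_update_coeff, ← hx]
        ring

theorem diffs_openCone {n : ℕ} {ι : Type} [Fintype ι] [DecidableEq ι] {v : ι → Fin n → ℚ}
    (hv : LinearIndependent ℚ v) {f : (Fin n → ℚ) → ℤ} (hf : ∀ j x, f (x + v j) = f x)
    (l : List ι) (hl : l.Nodup) :
    diffs (l.map v) (coneMul ((openCone v).indicator 1) f) =
      coneMul ((boxCone v l.toFinset).indicator 1) f := by
  induction l with
  | nil =>
    have : boxCone v (∅ : Finset ι) = openCone v := by
      ext x; simp [boxCone, openCone]
    simp [diffs, this]
  | cons j l ih =>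
    rw [List.nodup_cons] at hl
    change diff (v j) (diffs (l.map v) _) = _
    rw [ih hl.2, diff_boxCone hv (by simpa using hl.1) (hf j), List.toFinset_cons]

theorem support_parallelepiped_finite {n : ℕ} {ι : Type} [Fintype ι] (v : ι → Fin n → ℚ)
    {f : (Fin n → ℚ) → ℤ} (hf : f ∈ testFun n) :
    (parallelepipedPts v ∩ Function.support f).Finite := by
  obtain ⟨N, hN, _, h2⟩ := hf
  have hN' : (N : ℚ) ≠ 0 := by exact_mod_cast hN.ne'
  have hNr : (0 : ℝ) < N := by exact_mod_cast hN
  obtain ⟨B, hB⟩ : ∃ B : ℕ, ∀ i, (N : ℝ) * ∑ j, |(v j i : ℝ)| ≤ B := by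
    obtain ⟨B, hB⟩ := exists_nat_ge (∑ i, (N : ℝ) * ∑ j, |(v j i : ℝ)|)
    refine ⟨B, fun i => le_trans ?_ hB⟩
    exact Finset.single_le_sum (f := fun i => (N : ℝ) * ∑ j, |(v j i : ℝ)|)
      (fun i _ => by positivity) (Finset.mem_univ i)
  refine ((Set.finite_Icc (fun _ : Fin n => -(B : ℤ)) (fun _ => (B : ℤ))).image
    (fun m i => (m i : ℚ) / N)).subset ?_
  rintro w ⟨⟨t, ht, hx⟩, hw⟩
  obtain ⟨m, hm⟩ := h2 w hw
  have hmB : ∀ i, |(m i : ℝ)| ≤ B := by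
    intro i
    refine le_trans ?_ (hB i)
    have : (m i : ℝ) = N * (w i : ℝ) := by exact_mod_cast (hm i).symm
    rw [this, hx, abs_mul, abs_of_pos hNr]
    refine mul_le_mul_of_nonneg_left ?_ hNr.le
    refine (Finset.abs_sum_le_sum_abs _ _).trans (Finset.sum_le_sum fun j _ => ?_)
    rw [abs_mul, abs_of_pos (ht j).1]
    exact mul_le_of_le_one_left (abs_nonneg _) (ht j).2
  refine ⟨m, ⟨fun i => ?_, fun i => ?_⟩, ?_⟩
  · have := (abs_le.1 (hmB i)).1
    exact_mod_cast this
  · have := (abs_le.1 (hmB i)).2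
    exact_mod_cast this
  · funext i
    simp only
    rw [← hm i]
    field_simp

open Classical in
theorem isFormalSum_openCone {n : ℕ} {ι : Type} [Fintype ι] {v : ι → Fin n → ℚ}
    (hv : LinearIndependent ℚ v) {f : (Fin n → ℚ) → ℤ} (hf : f ∈ testFun n)
    (hper : ∀ j x, f (x + v j) = f x) :
    IsFormalSum (coneMul ((openCone v).indicator 1) f)
      ((∏ j, (1 - algebraMap _ (Laurent n) (expT (v j)))⁻¹) *
        ∑ᶠ w ∈ parallelepipedPts v, (f w : Laurent n) * algebraMap _ (Laurent n) (expT w)) := by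
  have hd := diffs_openCone hv hper Finset.univ.toList (Finset.nodup_toList _)
  rw [Finset.toList_toFinset] at hd
  have hbox : ∀ w : Fin n → ℚ, (fun i => (w i : ℝ)) ∈ boxCone v Finset.univ ↔
      w ∈ parallelepipedPts v := by
    intro w
    constructor
    · rintro ⟨t, ht, hs, hx⟩
      exact ⟨t, fun j => ⟨ht j, hs j (Finset.mem_univ j)⟩, hx⟩
    · rintro ⟨t, ht, hx⟩
      exact ⟨t, fun j => (ht j).1, fun j _ => (ht j).2, hx⟩
  have hval : coneMul ((boxCone v Finset.univ).indicator 1) f =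
      fun w => if w ∈ parallelepipedPts v then f w else 0 := by
    funext w
    simp only [coneMul, Set.indicator_apply, hbox]
    split_ifs <;> simp
  refine ⟨Finset.univ.toList.map v, fun u hu => ?_, ?_, ?_⟩
  · obtain ⟨j, _, rfl⟩ := List.mem_map.1 hu
    exact hv.ne_zero j
  · rw [hd, hval]
    refine (support_parallelepiped_finite v hf).subset fun w hw => ?_
    simp only [Function.mem_support, ne_eq, ite_eq_right_iff, not_forall] at hw
    exact ⟨hw.1, hw.2⟩
  · rw [hd, hval]
    have hden : denom (Finset.univ.toList.map v) =
        ∏ j, (1 - algebraMap _ (Laurent n) (expT (v j))) := by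
      unfold denom
      rw [List.map_map]
      exact Finset.prod_map_toList _ _
    have hne : (∏ j, (1 - algebraMap _ (Laurent n) (expT (v j)))) ≠ 0 :=
      Finset.prod_ne_zero_iff.2 fun j _ => one_sub_expT_ne_zero (hv.ne_zero j)
    rw [hden, Finset.prod_inv_distrib, mul_right_comm, inv_mul_cancel₀ hne, one_mul]
    unfold expSum
    apply finsum_congr
    intro w
    by_cases hw : w ∈ parallelepipedPts v
    · simp [hw]
    · simp [hw]

theorem openCone_smul {n : ℕ} {ι : Type} [Fintype ι] (v : ι → Fin n → ℚ) {D : ℚ} (hD : 0 < D) :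
    openCone (fun j => D • v j) = openCone v := by
  have hD' : (0 : ℝ) < D := by exact_mod_cast hD
  ext x
  constructor
  · rintro ⟨t, ht, hx⟩
    refine ⟨fun j => t j * D, fun j => mul_pos (ht j) hD', fun i => ?_⟩
    rw [hx]
    refine Finset.sum_congr rfl fun j _ => ?_
    simp only [Pi.smul_apply, smul_eq_mul]
    push_cast
    ring
  · rintro ⟨t, ht, hx⟩
    refine ⟨fun j => t j / D, fun j => div_pos (ht j) hD', fun i => ?_⟩
    rw [hx]
    refine Finset.sum_congr rfl fun j _ => ?_
    simp only [Pi.smul_apply, smul_eq_mul]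
    push_cast
    field_simp

theorem coneMul_add_left {n : ℕ} (c c' : (Fin n → ℝ) → ℤ) (f : (Fin n → ℚ) → ℤ) :
    coneMul (c + c') f = coneMul c f + coneMul c' f := by
  funext w; simp [coneMul, add_mul]

theorem coneMul_add_right {n : ℕ} (c : (Fin n → ℝ) → ℤ) (f f' : (Fin n → ℚ) → ℤ) :
    coneMul c (f + f') = coneMul c f + coneMul c f' := by
  funext w; simp [coneMul, mul_add]

/-- The formal sum `∑ w, c(w) f(w) e^{w · T}` has a value for each cone function `c` and each test
function `f`. -/
theorem exists_isFormalSum {n : ℕ} {c : (Fin n → ℝ) → ℤ} (hc : c ∈ coneGroup n)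
    {f : (Fin n → ℚ) → ℤ} (hf : f ∈ testFun n) : ∃ h, IsFormalSum (coneMul c f) h := by
  refine AddSubgroup.closure_induction (p := fun c _ => ∃ h, IsFormalSum (coneMul c f) h)
    ?_ ?_ ?_ ?_ hc
  · rintro _ ⟨r, v, hv, rfl⟩
    obtain ⟨D, hD, hz⟩ := exists_common_den (fun p : Fin r × Fin n => v p.1 p.2)
    choose z hz using hz
    have hf' := hf
    obtain ⟨N, hN, h1, _⟩ := hf'
    have hND : (0 : ℚ) < N * D := by exact_mod_cast Nat.mul_pos hN hD
    rw [← openCone_smul v hND]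
    refine ⟨_, isFormalSum_openCone (v := fun j => ((N : ℚ) * D) • v j) ?_ hf fun j x => ?_⟩
    · exact hv.units_smul (fun _ => Units.mk0 _ hND.ne')
    · rw [← h1 x (fun i => z (j, i))]
      congr 1
      funext i
      simp only [Pi.add_apply, Pi.smul_apply, smul_eq_mul]
      rw [← hz (j, i)]
      ring
  · refine ⟨0, ?_⟩
    have : coneMul (0 : (Fin n → ℝ) → ℤ) f = 0 := by funext w; simp [coneMul]
    rw [this]
    exact IsFormalSum.zero
  · rintro c c' _ _ ⟨h, H⟩ ⟨h', H'⟩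
    exact ⟨h + h', by rw [coneMul_add_left]; exact H.add H'⟩
  · rintro c _ ⟨h, H⟩
    refine ⟨-h, ?_⟩
    have : coneMul (-c) f = -coneMul c f := by funext w; simp [coneMul]
    rw [this]
    exact H.neg

/-- The Solomon–Hu pairing on cone functions: `⟨c, f⟩ = ∑ w, c(w) f(w) e^{w · T}`, the sum over
`w ∈ ℚⁿ` being given its value in `ℂ((T₁, …, Tₙ))`. -/
noncomputable def conePairing (n : ℕ) : coneGroup n →+ testFun n →+ Laurent n :=
  AddMonoidHom.mk' (fun c => AddMonoidHom.mk' (fun f => formalSum (coneMul c.1 f.1)) (by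
    intro f f'
    obtain ⟨h, H⟩ := exists_isFormalSum c.2 f.2
    obtain ⟨h', H'⟩ := exists_isFormalSum c.2 f'.2
    have := H.add H'
    rw [← coneMul_add_right] at this
    rw [H.formalSum_eq, H'.formalSum_eq]
    exact this.formalSum_eq)) (by
  intro c c'
  ext f
  obtain ⟨h, H⟩ := exists_isFormalSum c.2 f.2
  obtain ⟨h', H'⟩ := exists_isFormalSum c'.2 f.2
  have := H.add H'
  rw [← coneMul_add_left] at this
  change formalSum _ = formalSum _ + formalSum _
  rw [H.formalSum_eq, H'.formalSum_eq]
  exact this.formalSum_eq)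

/-- On the cone `c = χ_{ℝ⁺ v₁ + ⋯ + ℝ⁺ v_r}`, with `v₁, …, v_r` linearly independent periods of `f`,
the pairing is `⟨c, f⟩ = ∏ (1 - e^{v_j · T})⁻¹ ∑ f(w) e^{w · T}`, where `w` runs over the rational
points of `(0,1] v₁ + ⋯ + (0,1] v_r`. -/
theorem conePairing_openCone {n r : ℕ} {v : Fin r → Fin n → ℚ} (hv : LinearIndependent ℚ v)
    (f : testFun n) (hper : ∀ j x, f.1 (x + v j) = f.1 x) :
    conePairing n ⟨(openCone v).indicator 1, openCone_mem hv⟩ f =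
      (∏ j, (1 - algebraMap _ (Laurent n) (expT (v j)))⁻¹) *
        ∑ᶠ w ∈ parallelepipedPts v, (f.1 w : Laurent n) * algebraMap _ (Laurent n) (expT w) :=
  (isFormalSum_openCone hv f.2 hper).formalSum_eq

/-- The constant functions among the cone functions. -/
def constCone (n : ℕ) : AddSubgroup (coneGroup n) where
  carrier := {c | ∃ k : ℤ, ∀ x, c.1 x = k}
  zero_mem' := ⟨0, fun _ => rfl⟩
  add_mem' := by
    rintro c c' ⟨k, hk⟩ ⟨k', hk'⟩
    exact ⟨k + k', fun x => by simp [hk, hk']⟩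
  neg_mem' := by
    rintro c ⟨k, hk⟩
    exact ⟨-k, fun x => by simp [hk]⟩

/-- `ℒ_{ℚⁿ}`: the group generated by the characteristic functions of open rational cones, modulo
constant functions. -/
abbrev ConeFun (n : ℕ) : Type := coneGroup n ⧸ constCone n

theorem conePairing_const (n : ℕ) [NeZero n] (c : coneGroup n) (hc : c ∈ constCone n) :
    conePairing n c = 0 := by
  classical
  obtain ⟨k, hk⟩ := hc
  ext f
  obtain ⟨f, hf⟩ := f
  have hf' := hf
  obtain ⟨N, hN, h1, _⟩ := hf'
  have hN' : (N : ℚ) ≠ 0 := by exact_mod_cast hN.ne'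
  obtain ⟨v, hv, hper⟩ : ∃ v : Fin n → ℚ, v ≠ 0 ∧ ∀ x, f (x - v) = f x := by
    refine ⟨fun _ => N, fun h => hN' (congrFun h 0), fun x => ?_⟩
    rw [← h1 _ (fun _ => 1)]
    congr 1
    funext i
    simp
  have hz : diffs [v] (coneMul c.1 f) = 0 := by
    funext x
    simp [diffs, diff, coneMul, hk, hper]
  have H : IsFormalSum (coneMul c.1 f) 0 :=
    ⟨[v], by simpa using hv, by rw [hz]; simp, by rw [hz]; simp [expSum]⟩
  exact H.formalSum_eq

/-- The Solomon–Hu pairing `⟨·, ·⟩_SH : ℒ_{ℚⁿ} × 𝒮(ℚⁿ) → ℂ((T₁, …, Tₙ))`. -/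
noncomputable def solomonHu (n : ℕ) [NeZero n] : ConeFun n →+ testFun n →+ Laurent n :=
  QuotientAddGroup.lift (constCone n) (conePairing n) (conePairing_const n)

/-! ### The ordered field `𝔽 = ℝ((ε₁)) ⋯ ((εₙ))` and the Shintani cone function -/

/-- An ordered field, bundled. -/
structure OrderedFld : Type 1 where
  carrier : Type
  [field : Field carrier]
  [linearOrder : LinearOrder carrier]
  [isStrictOrderedRing : IsStrictOrderedRing carrier]

attribute [instance] OrderedFld.field OrderedFld.linearOrder OrderedFld.isStrictOrderedRing

/-- The tower `ℝ, ℝ((ε₁)), ℝ((ε₁))((ε₂)), …` of ordered fields. A nonzero Laurent series in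
`ε_{k+1}` is positive if its coefficient at the lowest power of `ε_{k+1}` is positive, so that
`ε_{k+1}` is smaller than every positive element of the previous field. -/
noncomputable def epsTower : ℕ → OrderedFld
  | 0 => ⟨ℝ⟩
  | k + 1 => ⟨Lex (HahnSeries ℤ (epsTower k).carrier)⟩

/-- The ordered field `ℝ((ε₁)) ⋯ ((εₙ))`. -/
abbrev EpsField (n : ℕ) : Type := (epsTower n).carrier

/-- `ℝ((ε₁)) ⋯ ((ε_{k+1}))` is the field of Laurent series in `ε_{k+1}` over
`ℝ((ε₁)) ⋯ ((ε_k))`. -/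
noncomputable def epsSeries (k : ℕ) : EpsField (k + 1) ≃+* HahnSeries ℤ (EpsField k) :=
  RingEquiv.refl (HahnSeries ℤ (EpsField k))

theorem epsField_pos_iff (k : ℕ) (x : EpsField (k + 1)) :
    0 < x ↔ ∃ j : ℤ, (∀ j' < j, (epsSeries k x).coeff j' = 0) ∧ 0 < (epsSeries k x).coeff j := by
  have h : 0 < x ↔ ∃ j : ℤ, (∀ j' < j, 0 = (epsSeries k x).coeff j') ∧
      0 < (epsSeries k x).coeff j :=
    HahnSeries.lt_iff (Γ := ℤ) (R := EpsField k) 0 x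
  rw [h]
  simp only [eq_comm]

/-- The embedding of constant Laurent series. -/
noncomputable def epsC (k : ℕ) : EpsField k →+* EpsField (k + 1) :=
  (epsSeries k).symm.toRingHom.comp HahnSeries.C

theorem epsSeries_epsC (k : ℕ) (x : EpsField k) : epsSeries k (epsC k x) = HahnSeries.C x := rfl

/-- The embedding `ℝ → ℝ((ε₁)) ⋯ ((εₙ))`. -/
noncomputable def realToEps : (n : ℕ) → ℝ →+* EpsField n
  | 0 => RingHom.id ℝ
  | k + 1 => (epsC k).comp (realToEps k)

/-- The elements `ε₁, …, εₙ` of `ℝ((ε₁)) ⋯ ((εₙ))`. -/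
noncomputable def eps : (n : ℕ) → Fin n → EpsField n
  | 0 => Fin.elim0
  | k + 1 => Fin.snoc (α := fun _ => EpsField (k + 1)) (fun i => epsC k (eps k i))
      ((epsSeries k).symm (HahnSeries.single 1 1))

/-- `b(ε) = (1, ε, …, ε^{n-1})ᵀ`. -/
def bVec {n : ℕ} {F : Type*} [Field F] (ε : F) : Fin n → F := fun i => ε ^ (i : ℕ)

open Classical in
/-- The function `c(v₁, …, vₙ) : 𝔽ⁿ → ℤ` on an ordered field `𝔽`: its value at `w` is
`sign det (v₁, …, vₙ)` if `w = ∑ λ_j v_j` with all `λ_j > 0`, and `0` otherwise. -/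
noncomputable def signedCone {n : ℕ} {F : Type*} [Field F] [LinearOrder F]
    (v : Fin n → Fin n → F) (w : Fin n → F) : ℤ :=
  if ∃ l : Fin n → F, (∀ j, 0 < l j) ∧ w = ∑ j, l j • v j then
    (SignType.sign (Matrix.of fun i j => v j i).det : ℤ)
  else 0

/-- The polyhedral cone function `σ_n^{Sh}(α₁, …, αₙ)(w) = c(α₁ b(ε₁), …, αₙ b(εₙ))(w)`. -/
noncomputable def sigmaSh {n : ℕ} (α : Fin n → GL (Fin n) ℚ) : (Fin n → ℝ) → ℤ :=
  fun w => signedCone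
    (fun j => (α j).1.map (Rat.cast : ℚ → EpsField n) *ᵥ bVec (eps n j))
    (fun i => realToEps n (w i))

/-- Polynomials in the `ε_j` (possibly with negative powers) with rational coefficients. -/
noncomputable def ratEps : (k : ℕ) → Subring (EpsField k)
  | 0 => (Rat.castHom ℝ).range
  | k + 1 =>
    { carrier := {x | (epsSeries k x).support.Finite ∧ ∀ j, (epsSeries k x).coeff j ∈ ratEps k}
      zero_mem' := by
        refine ⟨?_, fun j => ?_⟩
        · rw [map_zero, HahnSeries.support_zero]; exact Set.finite_empty
        · rw [map_zero, HahnSeries.coeff_zero]; exact zero_mem _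
      one_mem' := by
        refine ⟨?_, fun j => ?_⟩
        · rw [map_one, HahnSeries.support_one]; exact Set.finite_singleton _
        · rw [map_one, HahnSeries.coeff_one]
          split_ifs
          · exact one_mem _
          · exact zero_mem _
      add_mem' := by
        rintro x y ⟨hx, hx'⟩ ⟨hy, hy'⟩
        refine ⟨?_, fun j => ?_⟩
        · rw [map_add]; exact (hx.union hy).subset (HahnSeries.support_add_subset ..)
        · rw [map_add, HahnSeries.coeff_add]; exact add_mem (hx' j) (hy' j)
      neg_mem' := by
        rintro x ⟨hx, hx'⟩
        refine ⟨?_, fun j => ?_⟩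
        · rw [map_neg, HahnSeries.support_neg]; exact hx
        · rw [map_neg, HahnSeries.coeff_neg]; exact neg_mem (hx' j)
      mul_mem' := by
        rintro x y ⟨hx, hx'⟩ ⟨hy, hy'⟩
        refine ⟨?_, fun j => ?_⟩
        · rw [map_mul]; exact (hx.add hy).subset HahnSeries.support_mul_subset
        · rw [map_mul, HahnSeries.coeff_mul]
          exact sum_mem fun p _ => mul_mem (hx' _) (hy' _) }

theorem single_mem_ratEps (k : ℕ) (m : ℤ) {x : EpsField k} (hx : x ∈ ratEps k) :
    (epsSeries k).symm (HahnSeries.single m x) ∈ ratEps (k + 1) := by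
  change (epsSeries k _).support.Finite ∧ ∀ j, (epsSeries k _).coeff j ∈ ratEps k
  rw [RingEquiv.apply_symm_apply]
  refine ⟨(Set.finite_singleton m).subset HahnSeries.support_single_subset, fun j => ?_⟩
  rw [HahnSeries.coeff_single]
  split_ifs
  · exact hx
  · exact zero_mem _

theorem epsC_mem_ratEps (k : ℕ) {x : EpsField k} (hx : x ∈ ratEps k) :
    epsC k x ∈ ratEps (k + 1) :=
  single_mem_ratEps k 0 hx

theorem eps_mem_ratEps : ∀ (k : ℕ) (i : Fin k), eps k i ∈ ratEps k
  | 0, i => i.elim0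
  | k + 1, i => by
    refine Fin.lastCases ?_ (fun i => ?_) i
    · rw [eps, Fin.snoc_last]
      exact single_mem_ratEps k 1 (one_mem _)
    · rw [eps, Fin.snoc_castSucc]
      exact epsC_mem_ratEps k (eps_mem_ratEps k i)

theorem ratCast_mem_ratEps : ∀ (k : ℕ) (q : ℚ), (q : EpsField k) ∈ ratEps k
  | 0, q => ⟨q, rfl⟩
  | k + 1, q => by
    have := epsC_mem_ratEps k (ratCast_mem_ratEps k q)
    rwa [map_ratCast] at this

theorem isConeSet_ratEps : ∀ (k : ℕ) {n : ℕ} (a : Fin n → EpsField k), (∀ i, a i ∈ ratEps k) →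
    IsConeSet {w : Fin n → ℝ | 0 < ∑ i, a i * realToEps k (w i)}
  | 0, n, a, ha => by
    choose q hq using ha
    have : {w : Fin n → ℝ | 0 < ∑ i, a i * realToEps 0 (w i)} = {w | 0 < ratDot q w} := by
      ext w
      simp only [Set.mem_ofPred_eq, ratDot, ← hq]
      rfl
    rw [this]
    exact isConeSet_pos q
  | k + 1, n, a, ha => by
    classical
    let co : ℤ → Fin n → EpsField k := fun j i => (epsSeries k (a i)).coeff j
    have hco : ∀ j i, co j i ∈ ratEps k := fun j i => (ha i).2 j
    have hpos : ∀ j, IsConeSet {w : Fin n → ℝ | 0 < ∑ i, co j i * realToEps k (w i)} :=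
      fun j => isConeSet_ratEps k _ (hco j)
    have hzero : ∀ j, IsConeSet {w : Fin n → ℝ | ∑ i, co j i * realToEps k (w i) = 0} := by
      intro j
      have hneg := isConeSet_ratEps k (fun i => -co j i) (fun i => neg_mem (hco j i))
      have := ((hpos j).union hneg).compl
      convert this using 1
      ext w
      simp only [neg_mul, Finset.sum_neg_distrib, Set.mem_ofPred_eq, Set.mem_compl_iff,
        Set.mem_union, not_or, not_lt]
      constructor
      · intro h; simp [h]
      · rintro ⟨h1, h2⟩
        exact le_antisymm h1 (by simpa using h2)
    have hfin : (⋃ i, (epsSeries k (a i)).support).Finite := Set.finite_iUnion fun i => (ha i).1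
    have : Finite (⋃ i, (epsSeries k (a i)).support : Set ℤ) := hfin
    have hoff : ∀ j ∉ (⋃ i, (epsSeries k (a i)).support : Set ℤ), ∀ i, co j i = 0 := by
      intro j hj i
      by_contra h
      exact hj (Set.mem_iUnion.2 ⟨i, h⟩)
    have hcoeff : ∀ (w : Fin n → ℝ) (j : ℤ),
        (epsSeries k (∑ i, a i * realToEps (k + 1) (w i))).coeff j =
          ∑ i, co j i * realToEps k (w i) := by
      intro w j
      rw [map_sum, HahnSeries.coeff_sum]
      refine Finset.sum_congr rfl fun i _ => ?_
      rw [map_mul, realToEps, RingHom.comp_apply, epsSeries_epsC, mul_comm,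
        HahnSeries.C_mul_eq_smul, HahnSeries.coeff_smul, smul_eq_mul, mul_comm]
    have hset : {w : Fin n → ℝ | 0 < ∑ i, a i * realToEps (k + 1) (w i)} =
        ⋃ j : (⋃ i, (epsSeries k (a i)).support : Set ℤ),
          ({w : Fin n → ℝ | 0 < ∑ i, co j i * realToEps k (w i)} ∩
          ⋂ j' : {j' : (⋃ i, (epsSeries k (a i)).support : Set ℤ) // j'.1 < j.1},
            {w : Fin n → ℝ | ∑ i, co j'.1.1 i * realToEps k (w i) = 0}) := by
      ext w
      simp only [Set.mem_iUnion, Set.mem_inter_iff, Set.mem_iInter, Set.mem_ofPred_eq]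
      simp only [epsField_pos_iff, hcoeff]
      constructor
      · rintro ⟨j, h1, h2⟩
        have hj : j ∈ (⋃ i, (epsSeries k (a i)).support : Set ℤ) := by
          by_contra h
          simp [hoff j h] at h2
        exact ⟨⟨j, hj⟩, h2, fun j' => h1 _ j'.2⟩
      · rintro ⟨j, h1, h2⟩
        refine ⟨j.1, fun j' hj' => ?_, h1⟩
        by_cases h : j' ∈ (⋃ i, (epsSeries k (a i)).support : Set ℤ)
        · exact h2 ⟨⟨j', h⟩, hj'⟩
        · simp [hoff j' h]
    rw [hset]
    exact isConeSet_iUnion fun j => (hpos _).inter (isConeSet_iInter fun j' => hzero _)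

/-- `σ_n^{Sh}(α₁, …, αₙ)` is a cone function. -/
theorem sigmaSh_mem {n : ℕ} (α : Fin n → GL (Fin n) ℚ) : sigmaSh α ∈ coneGroup n := by
  classical
  set v : Fin n → Fin n → EpsField n :=
    fun j => (α j).1.map (Rat.cast : ℚ → EpsField n) *ᵥ bVec (eps n j) with hv
  set M : Matrix (Fin n) (Fin n) (EpsField n) := Matrix.of fun i j => v j i with hM
  have hvmem : ∀ j i, v j i ∈ ratEps n := by
    intro j i
    simp only [hv, Matrix.mulVec, dotProduct, Matrix.map_apply, bVec]
    exact sum_mem fun l _ => mul_mem (ratCast_mem_ratEps n _) (pow_mem (eps_mem_ratEps n j) _)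
  let M' : Matrix (Fin n) (Fin n) (ratEps n) := Matrix.of fun i j => ⟨v j i, hvmem j i⟩
  have hMM' : M = (ratEps n).subtype.mapMatrix M' := by
    ext i j; rfl
  have hdet : M.det ∈ ratEps n := by
    rw [hMM', ← RingHom.map_det]
    exact (M'.det).2
  have hadj : ∀ i j, M.adjugate i j ∈ ratEps n := by
    intro i j
    rw [hMM', ← RingHom.map_adjugate]
    exact (M'.adjugate i j).2
  have hset : IsConeSet (⋂ j, {w : Fin n → ℝ |
      0 < ∑ i, (M.det * M.adjugate j i) * realToEps n (w i)}) :=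
    isConeSet_iInter fun j => isConeSet_ratEps n _ fun i => mul_mem hdet (hadj j i)
  have hσ : sigmaSh α = ((SignType.sign M.det : SignType) : ℤ) • (⋂ j, {w : Fin n → ℝ |
      0 < ∑ i, (M.det * M.adjugate j i) * realToEps n (w i)}).indicator 1 := by
    funext w
    simp only [sigmaSh, signedCone, Pi.smul_apply, smul_eq_mul]
    change (if ∃ l : Fin n → EpsField n, (∀ j, 0 < l j) ∧
      (fun i => realToEps n (w i)) = ∑ j, l j • v j then _ else 0) = _
    by_cases h0 : M.det = 0
    · have h0' : (Matrix.of fun i j => v j i).det = 0 := h0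
      rw [h0']
      simp
    · have hiff : (∃ l : Fin n → EpsField n, (∀ j, 0 < l j) ∧
          (fun i => realToEps n (w i)) = ∑ j, l j • v j) ↔
          w ∈ (⋂ j, {w : Fin n → ℝ |
            0 < ∑ i, (M.det * M.adjugate j i) * realToEps n (w i)}) := by
        simp only [Set.mem_iInter, Set.mem_ofPred_eq]
        have hcomb : ∀ l : Fin n → EpsField n, ∑ j, l j • v j = M *ᵥ l := by
          intro l
          funext i
          simp [Matrix.mulVec, dotProduct, hM, Finset.sum_apply, mul_comm]
        have hsum : ∀ j, ∑ i, (M.det * M.adjugate j i) * realToEps n (w i) =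
            M.det * (M.adjugate *ᵥ fun i => realToEps n (w i)) j := by
          intro j
          simp only [Matrix.mulVec, dotProduct, Finset.mul_sum, mul_assoc]
        simp only [hcomb, hsum]
        have hsq : 0 < M.det * M.det := mul_self_pos.2 h0
        constructor
        · rintro ⟨l, hl, hw⟩ j
          rw [hw, Matrix.mulVec_mulVec, Matrix.adjugate_mul, Matrix.smul_mulVec,
            Matrix.one_mulVec, Pi.smul_apply, smul_eq_mul, ← mul_assoc]
          exact mul_pos hsq (hl j)
        · intro h
          refine ⟨(M.det)⁻¹ • (M.adjugate *ᵥ fun i => realToEps n (w i)), fun j => ?_, ?_⟩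
          · have e : ((M.det)⁻¹ • (M.adjugate *ᵥ fun i => realToEps n (w i))) j =
                (M.det * (M.adjugate *ᵥ fun i => realToEps n (w i)) j) / (M.det * M.det) := by
              simp only [Pi.smul_apply, smul_eq_mul]
              field_simp
            rw [e]
            exact div_pos (h j) hsq
          · rw [Matrix.mulVec_smul, Matrix.mulVec_mulVec, Matrix.mul_adjugate, Matrix.smul_mulVec,
              Matrix.one_mulVec, smul_smul, inv_mul_cancel₀ h0, one_smul]
      rw [Set.indicator_apply]
      simp only [hiff]
      split_ifs
      · simp only [Pi.one_apply, mul_one]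
        rfl
      · simp
  rw [hσ]
  exact zsmul_mem hset.indicator_mem _

/-! ### Test functions on `𝔸_fⁿ ∖ {0}` -/

/-- The ring `𝔸_f` of finite adeles of `ℚ`. -/
abbrev AdeleFin : Type := IsDedekindDomain.FiniteAdeleRing ℤ ℚ

/-- `𝒮(𝔸_fⁿ ∖ {0})`: the group of locally constant functions `𝔸_fⁿ ∖ {0} → ℤ` with compact
support. -/
def adelicTestFun (n : ℕ) : AddSubgroup ({x : Fin n → AdeleFin // x ≠ 0} → ℤ) where
  carrier := {f | IsLocallyConstant f ∧ HasCompactSupport f}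
  zero_mem' := ⟨IsLocallyConstant.const 0, HasCompactSupport.zero⟩
  add_mem' := fun hf hg => ⟨hf.1.add hg.1, hf.2.add hg.2⟩
  neg_mem' := fun hf => ⟨hf.1.neg, hf.2.neg⟩

open IsDedekindDomain in
theorem exists_nat_valuation_lt (v : HeightOneSpectrum ℤ) (γ : (WithZero (Multiplicative ℤ))ˣ) :
    ∃ N : ℕ, 0 < N ∧ v.valuation ℚ (N : ℚ) < γ := by
  obtain ⟨a, ha, ha0⟩ := Submodule.exists_mem_ne_zero_of_ne_bot v.ne_bot
  have hb : ((a.natAbs : ℕ) : ℤ) ∈ v.asIdeal := by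
    rcases Int.natAbs_eq a with h | h
    · rw [← h]; exact ha
    · have := neg_mem ha
      rwa [h, neg_neg] at this
  have hlt : v.valuation ℚ ((a.natAbs : ℕ) : ℚ) < 1 := by
    have := (v.valuation_lt_one_iff_mem (K := ℚ) ((a.natAbs : ℕ) : ℤ)).2 hb
    simpa using this
  obtain ⟨k, hk⟩ := exists_pow_lt₀ hlt γ
  refine ⟨a.natAbs ^ k, pow_pos (Int.natAbs_pos.2 ha0) k, ?_⟩
  rw [Nat.cast_pow, map_pow]
  exact hk

open IsDedekindDomain in
theorem valuation_int_mul_le (v : HeightOneSpectrum ℤ) (m : ℤ) (q : ℚ) :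
    v.valuation ℚ (q * m) ≤ v.valuation ℚ q := by
  rw [map_mul]
  have := v.valuation_le_one (K := ℚ) m
  exact mul_le_of_le_one_right' (by simpa using this)

open IsDedekindDomain in
theorem isOpen_adicIntegers : ∀ v : HeightOneSpectrum ℤ,
    IsOpen (v.adicCompletionIntegers ℚ : Set (v.adicCompletion ℚ)) :=
  fun _ => Valued.isOpen_valuationSubring _

open IsDedekindDomain in
theorem valued_algebraMap (v : HeightOneSpectrum ℤ) (q : ℚ) :
    Valued.v ((algebraMap ℚ AdeleFin q) v) = v.valuation ℚ q :=
  HeightOneSpectrum.valuedAdicCompletion_eq_valuation' v q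

open IsDedekindDomain in
theorem algebraMap_mem_adicIntegers (v : HeightOneSpectrum ℤ) (m : ℤ) :
    (algebraMap ℚ AdeleFin m) v ∈ v.adicCompletionIntegers ℚ := by
  rw [HeightOneSpectrum.mem_adicCompletionIntegers, valued_algebraMap]
  have := v.valuation_le_one (K := ℚ) m
  simpa using this

open IsDedekindDomain in
/-- Every neighbourhood of `0` in `𝔸_f` contains `N ℤ` for some `N ≥ 1`. -/
theorem exists_nat_mul_int_mem {U : Set AdeleFin} (hU : U ∈ nhds (0 : AdeleFin)) :
    ∃ N : ℕ, 0 < N ∧ ∀ m : ℤ, algebraMap ℚ AdeleFin ((N : ℚ) * m) ∈ U := by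
  classical
  have h1 : RestrictedProduct.structureMap (fun v : HeightOneSpectrum ℤ => v.adicCompletion ℚ)
      (fun v => (v.adicCompletionIntegers ℚ : Set (v.adicCompletion ℚ))) Filter.cofinite ⁻¹' U ∈
      nhds 0 :=
    (RestrictedProduct.isEmbedding_structureMap.continuous.tendsto 0) hU
  rw [nhds_pi, Filter.mem_pi] at h1
  obtain ⟨I, hI, t, ht, hsub⟩ := h1
  have hN : ∀ v : HeightOneSpectrum ℤ, ∃ N : ℕ, 0 < N ∧ ∀ x : v.adicCompletionIntegers ℚ,
      Valued.v (x : v.adicCompletion ℚ) ≤ v.valuation ℚ (N : ℚ) → x ∈ t v := by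
    intro v
    have := ht v
    rw [Pi.zero_apply, mem_nhds_subtype] at this
    obtain ⟨u, hu, hut⟩ := this
    obtain ⟨γ, hγ⟩ := Valued.mem_nhds_zero.1 hu
    obtain ⟨N, hN, hlt⟩ := exists_nat_valuation_lt v
      (Units.map (MonoidWithZeroHom.ValueGroup₀.embedding : _ →*₀ _).toMonoidHom γ)
    refine ⟨N, hN, fun x hx => hut (hγ ?_)⟩
    exact (Valuation.restrict_lt_iff_lt_embedding _).2 (lt_of_le_of_lt hx hlt)
  choose N hN0 hN using hN
  refine ⟨∏ v ∈ hI.toFinset, N v, Finset.prod_pos fun v _ => hN0 v, fun m => ?_⟩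
  set q : ℚ := ((∏ v ∈ hI.toFinset, N v : ℕ) : ℚ) * m with hq
  have hint : ∀ v : HeightOneSpectrum ℤ,
      (algebraMap ℚ AdeleFin q) v ∈ v.adicCompletionIntegers ℚ := by
    intro v
    have := algebraMap_mem_adicIntegers v ((∏ v ∈ hI.toFinset, N v : ℕ) * m)
    rwa [Int.cast_mul, Int.cast_natCast] at this
  have hmem : (fun v : HeightOneSpectrum ℤ =>
      (⟨(algebraMap ℚ AdeleFin q) v, hint v⟩ : v.adicCompletionIntegers ℚ)) ∈ I.pi t := by
    intro v hv
    apply hN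
    change Valued.v ((algebraMap ℚ AdeleFin q) v) ≤ _
    rw [valued_algebraMap]
    obtain ⟨c, hc⟩ := Finset.dvd_prod_of_mem N (hI.mem_toFinset.2 hv)
    have : q = (N v : ℚ) * ((c * m : ℤ) : ℚ) := by
      rw [hq, hc]; push_cast; ring
    rw [this]
    exact valuation_int_mul_le v _ _
  exact hsub hmem

open IsDedekindDomain in
/-- A compact subset of `𝔸_f` lies in `N⁻¹ ∏_p ℤ_p` for some `N ≥ 1`. -/
theorem exists_nat_mul_integral {K : Set AdeleFin} (hK : IsCompact K) :
    ∃ N : ℕ, 0 < N ∧ ∀ q : ℚ, algebraMap ℚ AdeleFin q ∈ K → ∃ m : ℤ, (N : ℚ) * q = m := by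
  classical
  let O : Set AdeleFin := {x | ∀ v, x v ∈ v.adicCompletionIntegers ℚ}
  have hO : IsOpen O := RestrictedProduct.isOpen_forall_mem isOpen_adicIntegers
  let U : {N : ℕ // 0 < N} → Set AdeleFin := fun N => {x | (algebraMap ℚ AdeleFin N.1) * x ∈ O}
  have hUo : ∀ N, IsOpen (U N) := fun N => hO.preimage (continuous_const.mul continuous_id)
  have happly : ∀ (x y : AdeleFin) v, (x * y) v = x v * y v := fun x y v => rfl
  have hint : ∀ (c : ℕ) v, (algebraMap ℚ AdeleFin c) v ∈ v.adicCompletionIntegers ℚ := by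
    intro c v
    have := algebraMap_mem_adicIntegers v c
    rwa [Int.cast_natCast] at this
  have hmono : ∀ (N c : ℕ) (hN : 0 < N) (hc : 0 < c),
      U ⟨N, hN⟩ ⊆ U ⟨N * c, Nat.mul_pos hN hc⟩ := by
    intro N c hN hc x hx v
    have h1 := hx v
    rw [happly] at h1 ⊢
    change (algebraMap ℚ AdeleFin ((N * c : ℕ) : ℚ)) v * x v ∈ _
    rw [Nat.mul_comm N c, Nat.cast_mul, map_mul, happly, mul_assoc]
    exact mul_mem (hint c v) h1
  have hcover : K ⊆ ⋃ N, U N := by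
    intro x _
    have hfin : {v : HeightOneSpectrum ℤ | x v ∉ v.adicCompletionIntegers ℚ}.Finite := x.2
    have hN : ∀ v : HeightOneSpectrum ℤ, ∃ N : ℕ, 0 < N ∧
        (algebraMap ℚ AdeleFin N) v * x v ∈ v.adicCompletionIntegers ℚ := by
      intro v
      by_cases hx0 : x v = 0
      · exact ⟨1, one_pos, by rw [hx0, mul_zero]; exact zero_mem _⟩
      · have hne : Valued.v (x v) ≠ 0 := (Valuation.ne_zero_iff _).2 hx0
        obtain ⟨N, hN, hlt⟩ := exists_nat_valuation_lt v (Units.mk0 _ hne)⁻¹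
        refine ⟨N, hN, ?_⟩
        rw [HeightOneSpectrum.mem_adicCompletionIntegers, map_mul, valued_algebraMap]
        rw [Units.val_inv_eq_inv_val, Units.val_mk0] at hlt
        calc _ ≤ (Valued.v (x v))⁻¹ * Valued.v (x v) := mul_le_mul_left hlt.le _
          _ = 1 := inv_mul_cancel₀ hne
    choose N hN0 hN using hN
    rw [Set.mem_iUnion]
    refine ⟨⟨∏ v ∈ hfin.toFinset, N v, Finset.prod_pos fun v _ => hN0 v⟩, fun v => ?_⟩
    rw [happly]
    change (algebraMap ℚ AdeleFin ((∏ v ∈ hfin.toFinset, N v : ℕ) : ℚ)) v * x v ∈ _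
    by_cases hv : x v ∈ v.adicCompletionIntegers ℚ
    · exact mul_mem (hint _ v) hv
    · obtain ⟨c, hc⟩ := Finset.dvd_prod_of_mem N (hfin.mem_toFinset.2 hv)
      rw [hc, Nat.mul_comm, Nat.cast_mul, map_mul, happly, mul_assoc]
      exact mul_mem (hint _ v) (hN v)
  have : Nonempty {N : ℕ // 0 < N} := ⟨⟨1, one_pos⟩⟩
  obtain ⟨N, hN⟩ := hK.elim_directed_cover U hUo hcover (by
    rintro ⟨N, hN⟩ ⟨M, hM⟩
    refine ⟨⟨N * M, Nat.mul_pos hN hM⟩, hmono N M hN hM, ?_⟩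
    have := hmono M N hM hN
    simpa only [mul_comm M N] using this)
  refine ⟨N.1, N.2, fun q hq => ?_⟩
  have h1 : ∀ v : HeightOneSpectrum ℤ, v.valuation ℚ ((N.1 : ℚ) * q) ≤ 1 := by
    intro v
    have := hN hq v
    rw [← map_mul, HeightOneSpectrum.mem_adicCompletionIntegers, valued_algebraMap] at this
    exact this
  obtain ⟨m, hm⟩ := HeightOneSpectrum.mem_integers_of_valuation_le_one ℚ _ h1
  exact ⟨m, by simpa using hm.symm⟩

noncomputable section

instance adeleFin_t2Space : T2Space AdeleFin :=
  inferInstanceAs (T2Space (RestrictedProduct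
    (fun v : IsDedekindDomain.HeightOneSpectrum ℤ => v.adicCompletion ℚ)
    (fun v => (v.adicCompletionIntegers ℚ : Set (v.adicCompletion ℚ))) Filter.cofinite))

/-- The embedding `ℚⁿ ⊆ 𝔸_fⁿ`. -/
def ratToAdele {n : ℕ} (w : Fin n → ℚ) : Fin n → AdeleFin := fun i => algebraMap ℚ AdeleFin (w i)

/-- The extension by `0` to `𝔸_fⁿ` of a function on `𝔸_fⁿ ∖ {0}`. -/
def extendZero {n : ℕ} (f : {x : Fin n → AdeleFin // x ≠ 0} → ℤ) : (Fin n → AdeleFin) → ℤ :=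
  Function.extend Subtype.val f 0

theorem extendZero_mem {n : ℕ} {f : {x : Fin n → AdeleFin // x ≠ 0} → ℤ}
    (hf : f ∈ adelicTestFun n) :
    Continuous (extendZero f) ∧ HasCompactSupport (extendZero f) := by
  have hU : IsOpen {x : Fin n → AdeleFin | x ≠ 0} := isOpen_ne
  refine ⟨HasCompactSupport.continuous_extend_zero (U := {x : Fin n → AdeleFin | x ≠ 0}) hU
    hf.1.continuous hf.2, ?_⟩
  refine HasCompactSupport.intro (hf.2.isCompact.image continuous_subtype_val) fun x hx => ?_
  by_cases h : x = 0
  · apply Function.extend_apply'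
    rintro ⟨y, hy⟩
    exact y.2 (hy.trans h)
  · have := Function.Injective.extend_apply Subtype.val_injective f 0 ⟨x, h⟩
    refine this.trans ?_
    by_contra h0
    exact hx ⟨⟨x, h⟩, subset_tsupport _ h0, rfl⟩

/-- A continuous compactly supported integer function on `𝔸_fⁿ` is invariant under translation by
some neighbourhood of `0`. -/
theorem exists_nhds_invariant {n : ℕ} {F : (Fin n → AdeleFin) → ℤ} (hF : Continuous F)
    (hc : HasCompactSupport F) :
    ∀ᶠ u in nhds (0 : Fin n → AdeleFin), ∀ x, F (x + u) = F x := by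
  have h1 : ∀ᶠ u in nhds (0 : Fin n → AdeleFin), ∀ x ∈ tsupport F, F (x + u) = F x := by
    apply IsCompact.eventually_forall_of_forall_eventually hc
    intro x _
    have c1 : ContinuousAt (fun p : (Fin n → AdeleFin) × (Fin n → AdeleFin) =>
        F (p.2 + p.1) - F p.2) (0, x) := by
      apply Continuous.continuousAt
      exact (hF.comp (continuous_snd.add continuous_fst)).sub (hF.comp continuous_snd)
    have := c1.eventually (p := fun z => z = 0) (by
      simp only [add_zero, sub_self]
      exact (isOpen_discrete {(0 : ℤ)}).mem_nhds rfl)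
    filter_upwards [this] with p hp
    exact sub_eq_zero.1 hp
  have h2 : ∀ᶠ u in nhds (0 : Fin n → AdeleFin), ∀ x ∈ tsupport F, F (x + -u) = F x := by
    have : Filter.Tendsto (fun u : Fin n → AdeleFin => -u) (nhds 0) (nhds 0) := by
      simpa using (continuous_neg (G := Fin n → AdeleFin)).tendsto 0
    exact this.eventually h1
  filter_upwards [h1, h2] with u hu hu' x
  by_cases hx : x ∈ tsupport F
  · exact hu x hx
  · by_cases hy : x + u ∈ tsupport F
    · have := hu' _ hy
      rw [add_neg_cancel_right] at this
      exact this.symm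
    · rw [image_eq_zero_of_notMem_tsupport hx, image_eq_zero_of_notMem_tsupport hy]

theorem comp_ratToAdele_mem {n : ℕ} {F : (Fin n → AdeleFin) → ℤ} (hF : Continuous F)
    (hc : HasCompactSupport F) : (fun w => F (ratToAdele w)) ∈ testFun n := by
  have hinv := exists_nhds_invariant hF hc
  rw [Filter.Eventually, nhds_pi, Filter.mem_pi] at hinv
  obtain ⟨I, _, t, ht, hsub⟩ := hinv
  choose N hN0 hN using fun i => exists_nat_mul_int_mem (ht i)
  choose M hM0 hM using fun i : Fin n => exists_nat_mul_integral
    (hc.isCompact.image (continuous_apply i))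
  refine ⟨(∏ i, N i) * ∏ i, M i, Nat.mul_pos (Finset.prod_pos fun i _ => hN0 i)
    (Finset.prod_pos fun i _ => hM0 i), fun x m => ?_, fun x hx => ?_⟩
  · have hmem : (ratToAdele fun i => (((∏ i, N i) * ∏ i, M i : ℕ) : ℚ) * m i) ∈ I.pi t := by
      intro i _
      obtain ⟨c, hc⟩ := Finset.dvd_prod_of_mem N (Finset.mem_univ i)
      have := hN i (c * (∏ i, M i : ℕ) * m i)
      rw [hc]
      convert this using 1
      simp only [ratToAdele]
      congr 1
      push_cast
      ring
    have := hsub hmem (ratToAdele x)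
    refine Eq.trans (congrArg F ?_) this
    funext i
    simp [ratToAdele]
  · have hx' : ratToAdele x ∈ tsupport F := subset_tsupport F hx
    choose z hz using fun i => hM i (x i) ⟨_, hx', rfl⟩
    choose c hc using fun i => Finset.dvd_prod_of_mem M (Finset.mem_univ i)
    refine ⟨fun i => (∏ i, N i : ℕ) * c i * z i, fun i => ?_⟩
    have e := hz i
    rw [Nat.cast_mul, hc i]
    push_cast
    rw [← e]
    ring

/-- The restriction of test functions along `ℚⁿ ⊆ 𝔸_fⁿ`: an `f ∈ 𝒮(𝔸_fⁿ ∖ {0})`, extended by zero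
to `𝔸_fⁿ`, is restricted to `ℚⁿ`. -/
def adelicRes (n : ℕ) : adelicTestFun n →+ testFun n where
  toFun f := ⟨fun w => extendZero f.1 (ratToAdele w),
    comp_ratToAdele_mem (extendZero_mem f.2).1 (extendZero_mem f.2).2⟩
  map_zero' := by
    ext w
    change Function.extend Subtype.val (0 : {x : Fin n → AdeleFin // x ≠ 0} → ℤ) 0 _ = 0
    rw [Function.extend]
    split_ifs <;> rfl
  map_add' f g := by
    ext w
    change Function.extend Subtype.val (f.1 + g.1) 0 _ =
      Function.extend Subtype.val f.1 0 _ + Function.extend Subtype.val g.1 0 _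
    simp only [Function.extend]
    split_ifs <;> rfl

/-- The image of `γ ∈ GLₙ(ℚ)` in `GLₙ(𝔸_f)`. -/
def adelicMat {n : ℕ} (γ : GL (Fin n) ℚ) : Matrix (Fin n) (Fin n) AdeleFin :=
  γ.1.map (algebraMap ℚ AdeleFin)

theorem adelicMat_mul {n : ℕ} (γ δ : GL (Fin n) ℚ) :
    adelicMat (γ * δ) = adelicMat γ * adelicMat δ := by
  simp [adelicMat, Matrix.map_mul]

theorem adelicMat_one {n : ℕ} : adelicMat (1 : GL (Fin n) ℚ) = 1 := by
  simp [adelicMat]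

theorem vecMul_adelicMat_inv {n : ℕ} (γ : GL (Fin n) ℚ) (x : Fin n → AdeleFin) :
    (x ᵥ* adelicMat γ) ᵥ* adelicMat γ⁻¹ = x := by
  rw [Matrix.vecMul_vecMul, ← adelicMat_mul, mul_inv_cancel, adelicMat_one, Matrix.vecMul_one]

theorem vecMul_adelicMat_ne {n : ℕ} (γ : GL (Fin n) ℚ) {x : Fin n → AdeleFin} (hx : x ≠ 0) :
    x ᵥ* adelicMat γ ≠ 0 := by
  intro h
  apply hx
  rw [← vecMul_adelicMat_inv γ x, h, Matrix.zero_vecMul]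

/-- The homeomorphism `x ↦ x γ` of `𝔸_fⁿ ∖ {0}`, with `x` a row vector. -/
def adelicHomeo {n : ℕ} (γ : GL (Fin n) ℚ) :
    {x : Fin n → AdeleFin // x ≠ 0} ≃ₜ {x : Fin n → AdeleFin // x ≠ 0} where
  toFun x := ⟨x.1 ᵥ* adelicMat γ, vecMul_adelicMat_ne γ x.2⟩
  invFun x := ⟨x.1 ᵥ* adelicMat γ⁻¹, vecMul_adelicMat_ne γ⁻¹ x.2⟩
  left_inv x := Subtype.ext (vecMul_adelicMat_inv γ x.1)
  right_inv x := Subtype.ext (by simpa using vecMul_adelicMat_inv γ⁻¹ x.1)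
  continuous_toFun := Continuous.subtype_mk
    (continuous_subtype_val.matrix_vecMul continuous_const) _
  continuous_invFun := Continuous.subtype_mk
    (continuous_subtype_val.matrix_vecMul continuous_const) _

/-- The left action of `GLₙ(ℚ)` on `𝒮(𝔸_fⁿ ∖ {0})`: `(γ · f)(x) = f(x γ)`. -/
def adelicTestFunAct {n : ℕ} (γ : GL (Fin n) ℚ) : adelicTestFun n →+ adelicTestFun n where
  toFun f := ⟨fun x => f.1 (adelicHomeo γ x),
    f.2.1.comp_continuous (adelicHomeo γ).continuous, f.2.2.comp_homeomorph (adelicHomeo γ)⟩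
  map_zero' := rfl
  map_add' _ _ := rfl

end

/-! ### Distributions and the Shintani functions -/

/-- The transpose `γᵀ ∈ GLₙ(ℚ)`. -/
def transposeGL {n : ℕ} (γ : GL (Fin n) ℚ) : GL (Fin n) ℚ where
  val := γ.1ᵀ
  inv := (γ⁻¹).1ᵀ
  val_inv := by rw [← Matrix.transpose_mul, ← Units.val_mul, inv_mul_cancel]; simp
  inv_val := by rw [← Matrix.transpose_mul, ← Units.val_mul, mul_inv_cancel]; simp

/-- `Dist(ℚⁿ, ℂ((T₁, …, Tₙ)))`. -/
abbrev Dist (n : ℕ) : Type := testFun n →+ Laurent n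

/-- `Dist(𝔸_fⁿ ∖ {0}, ℂ((T₁, …, Tₙ)))`. -/
abbrev AdelicDist (n : ℕ) : Type := adelicTestFun n →+ Laurent n

/-- The right action of `GLₙ(ℚ)` on `Dist(ℚⁿ, ℂ((T)))`: `(μ|_γ)(f) = γᵀ · μ(γ · f)`. -/
noncomputable def Dist.slash {n : ℕ} (μ : Dist n) (γ : GL (Fin n) ℚ) : Dist n :=
  ((laurentAct (transposeGL γ)).toAddMonoidHom.comp μ).comp (testFunAct γ)

/-- The right action of `GLₙ(ℚ)` on `Dist(𝔸_fⁿ ∖ {0}, ℂ((T)))`: `(μ|_γ)(f) = γᵀ · μ(γ · f)`. -/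
noncomputable def AdelicDist.slash {n : ℕ} (μ : AdelicDist n) (γ : GL (Fin n) ℚ) :
    AdelicDist n :=
  ((laurentAct (transposeGL γ)).toAddMonoidHom.comp μ).comp (adelicTestFunAct γ)

/-- The distribution `f ↦ ⟨σ_n^{Sh}(γ₁, …, γₙ), f⟩_SH` on `ℚⁿ`. -/
noncomputable def PhiShRat {n : ℕ} [NeZero n] (γ : Fin n → GL (Fin n) ℚ) : Dist n :=
  solomonHu n (QuotientAddGroup.mk ⟨sigmaSh γ, sigmaSh_mem γ⟩)

/-- The Shintani cocycle `Φ_n^{Sh}(γ₁, …, γₙ) = ⟨σ_n^{Sh}(γ₁, …, γₙ), ·⟩_SH`, a distribution on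
`𝔸_fⁿ ∖ {0}`; the pairing with `f` only involves the values of `f` on `ℚⁿ ∖ {0}`. -/
noncomputable def PhiSh {n : ℕ} [NeZero n] (γ : Fin n → GL (Fin n) ℚ) : AdelicDist n :=
  (PhiShRat γ).comp (adelicRes n)

/-- The cone `ℝ⁺ e₁ γ₁ᵀ + ⋯ + ℝ⁺ e₁ γₙᵀ`, where `e₁ = (1, 0, …, 0)` is a row vector. -/
def naiveCone {n : ℕ} [NeZero n] (γ : Fin n → GL (Fin n) ℚ) : Set (Fin n → ℝ) :=
  openCone fun j => (Pi.single 0 1 : Fin n → ℚ) ᵥ* (γ j).1ᵀ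

/-- The Naive Shintani function `Φ_n^{NSh}(γ₁, …, γₙ)(f) = ⟨χ_{ℝ⁺ e₁ γ₁ᵀ + ⋯ + ℝ⁺ e₁ γₙᵀ}, f⟩_SH`. -/
noncomputable def PhiNSh {n : ℕ} [NeZero n] (γ : Fin n → GL (Fin n) ℚ) : Dist n :=
  solomonHu n (QuotientAddGroup.mk ⟨(naiveCone γ).indicator 1, openCone_mem_coneGroup _⟩)

/-- `sign γ = sign (det γ) ∈ {1, -1}`. -/
def signGL {n : ℕ} (γ : GL (Fin n) ℚ) : ℤ := (SignType.sign γ.1.det : ℤ)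

end ShintaniCocycle

namespace ShintaniCocycle

/-! The pairing `⟨c, f⟩` is the value of the formal sum `∑ c(w) f(w) e^{w · T}` over `w ∈ ℚⁿ`, and
the whole result is the change of variables `w ↦ γ w` in that sum.

The substitution `T ↦ T γ` sends `w · T` to `(γ w) · T`, hence `e^{w · T}` to `e^{(γ w) · T}`
(`substMat_expT`). Slashing by `γᵀ` replaces `f(w)` by `f(w γᵀ) = f(γ w)` and then applies `(γᵀ)ᵀ =
γ` to the series, so it turns the sum into `∑ c(w) f(γ w) e^{(γ w) · T} = ∑ c(γ⁻¹ w) f(w) e^{w ·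
T}`. This computation is legitimate for infinite sums because their values are defined by finite
certificates: a list of vectors `v` for which multiplication by `∏ (1 - e^{v · T})` makes the sum
finite. Moving each `v` to `γ v` transports the certificate (`IsFormalSum.comp_inv`). Thus any cone
functions with `c'(γ w) = c(w)` on `ℚⁿ` have pairings related by the slash action
(`conePairing_slash`).

What remains is geometry of cones. For the Shintani function, multiplying every generator and the
point by `γ` leaves the coefficients of the point unchanged and multiplies the determinant by `det
γ`, which produces the sign (`signedCone_mulVec`, `sigmaSh_mul`). The naive cone is carried to its
image with no determinant involved, so no sign appears (`naiveCone_mul`). The adelic statement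
follows from the one on `ℚⁿ`, since restriction from `𝔸_fⁿ ∖ {0}` to `ℚⁿ` commutes with the actions
of `GLₙ(ℚ)` (`adelicRes_adelicTestFunAct`). -/

/-! ### Linear substitutions and exponentials -/

theorem substMat_linForm {n : ℕ} (γ : Matrix (Fin n) (Fin n) ℚ) (w : Fin n → ℚ) :
    substMat γ (linForm w) = linForm (γ *ᵥ w) := by
  unfold substMat
  simp only [AlgHom.toRingHom_eq_coe, RingHom.coe_coe]
  conv_lhs => rw [linForm, map_sum]
  simp only [map_smul, MvPowerSeries.substAlgHom_X]
  simp only [linForm, Finset.smul_sum, smul_smul, Matrix.mulVec, dotProduct, Rat.cast_sum,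
    Rat.cast_mul, Finset.sum_smul]
  rw [Finset.sum_comm]
  simp only [mul_comm]

/-- Substitution is associative: `expT w` is already the univariate exponential evaluated at a
linear form without constant term, so a further substitution only changes that form. -/
theorem substMat_expT {n : ℕ} (γ : Matrix (Fin n) (Fin n) ℚ) (w : Fin n → ℚ) :
    substMat γ (expT w) = expT (γ *ᵥ w) := by
  have hs : MvPowerSeries.HasSubst (fun j => linForm fun i => γ i j) :=
    MvPowerSeries.hasSubst_of_constantCoeff_zero fun _ => constantCoeff_linForm _
  have hsubst : ∀ F, substMat γ F = MvPowerSeries.subst (fun j => linForm fun i => γ i j) F := by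
    intro F
    exact MvPowerSeries.substAlgHom_apply hs F
  unfold expT
  rw [← substMat_linForm, hsubst, hsubst]
  exact MvPowerSeries.subst_comp_subst_apply
    (PowerSeries.HasSubst.of_constantCoeff_zero (constantCoeff_linForm w)).const hs _

theorem laurentAct_expT {n : ℕ} (γ : GL (Fin n) ℚ) (w : Fin n → ℚ) :
    laurentAct γ (algebraMap _ (Laurent n) (expT w)) =
      algebraMap _ (Laurent n) (expT (γ.1 *ᵥ w)) := by
  rw [laurentAct, IsFractionRing.ringEquivOfRingEquiv_algebraMap]
  exact congrArg _ (substMat_expT γ.1 w)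

/-! ### Change of variables in formal sums -/

theorem inv_mulVec_mulVec {n : ℕ} (γ : GL (Fin n) ℚ) (w : Fin n → ℚ) :
    (γ⁻¹).1 *ᵥ (γ.1 *ᵥ w) = w := by
  rw [Matrix.mulVec_mulVec, ← Units.val_mul, inv_mul_cancel]
  simp

theorem mulVec_inv_mulVec {n : ℕ} (γ : GL (Fin n) ℚ) (w : Fin n → ℚ) :
    γ.1 *ᵥ ((γ⁻¹).1 *ᵥ w) = w := by
  rw [Matrix.mulVec_mulVec, ← Units.val_mul, mul_inv_cancel]
  simp

/-- The bijection `w ↦ γ w` of `ℚⁿ`. -/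
def mulVecEquiv {n : ℕ} (γ : GL (Fin n) ℚ) : (Fin n → ℚ) ≃ (Fin n → ℚ) where
  toFun w := γ.1 *ᵥ w
  invFun w := (γ⁻¹).1 *ᵥ w
  left_inv := inv_mulVec_mulVec γ
  right_inv := mulVec_inv_mulVec γ

/-- Because `γ⁻¹ (w - γ v) = γ⁻¹ w - v`, transport by `γ` conjugates translation by `v` into
translation by `γ v`, one difference operator at a time. -/
theorem diffs_comp_inv {n : ℕ} (γ : GL (Fin n) ℚ) (l : List (Fin n → ℚ))
    (g : (Fin n → ℚ) → ℤ) :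
    diffs (l.map fun v => γ.1 *ᵥ v) (fun w => g ((γ⁻¹).1 *ᵥ w)) =
      fun w => diffs l g ((γ⁻¹).1 *ᵥ w) := by
  induction l with
  | nil => rfl
  | cons v l ih =>
    change diff (γ.1 *ᵥ v) (diffs (l.map fun v => γ.1 *ᵥ v) _) = fun w => diff v (diffs l g) _
    rw [ih]
    funext w
    simp only [diff, Matrix.mulVec_sub, inv_mulVec_mulVec]

theorem support_comp_inv_finite {n : ℕ} (γ : GL (Fin n) ℚ) {P : (Fin n → ℚ) → ℤ}
    (hP : (Function.support P).Finite) :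
    (Function.support fun w => P ((γ⁻¹).1 *ᵥ w)).Finite :=
  hP.preimage (mulVecEquiv γ).symm.injective.injOn

theorem expSum_comp_inv {n : ℕ} (γ : GL (Fin n) ℚ) {P : (Fin n → ℚ) → ℤ}
    (hP : (Function.support P).Finite) :
    expSum (fun w => P ((γ⁻¹).1 *ᵥ w)) = laurentAct γ (expSum P) := by
  unfold expSum
  -- Reindexing the left side by `w ↦ γ w` moves `γ` from the coefficient to the exponent. On the
  -- right, the finite support of `P` is what lets the automorphism pass through the `finsum`.
  rw [← finsum_comp_equiv (mulVecEquiv γ),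
    show laurentAct γ (∑ᶠ w, (P w : Laurent n) * algebraMap _ (Laurent n) (expT w)) =
      ∑ᶠ w, laurentAct γ ((P w : Laurent n) * algebraMap _ (Laurent n) (expT w)) from
    (laurentAct γ).toAddMonoidHom.map_finsum (expSum_support hP)]
  refine finsum_congr fun w => ?_
  rw [map_mul, map_intCast, laurentAct_expT]
  simp only [mulVecEquiv, Equiv.coe_fn_mk, inv_mulVec_mulVec]

theorem laurentAct_denom {n : ℕ} (γ : GL (Fin n) ℚ) (l : List (Fin n → ℚ)) :
    laurentAct γ (denom l) = denom (l.map fun v => γ.1 *ᵥ v) := by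
  unfold denom
  rw [map_list_prod, List.map_map, List.map_map]
  congr 2
  funext v
  simp only [Function.comp_apply, map_sub, map_one, laurentAct_expT]

/-- Change of variables `w ↦ γ w` in a formal sum `∑ w, g(w) e^{w · T}`. -/
theorem IsFormalSum.comp_inv {n : ℕ} (γ : GL (Fin n) ℚ) {g : (Fin n → ℚ) → ℤ} {h : Laurent n}
    (H : IsFormalSum g h) : IsFormalSum (fun w => g ((γ⁻¹).1 *ᵥ w)) (laurentAct γ h) := by
  obtain ⟨l, hl, hs, e⟩ := H
  -- The certificate for `g` is transported: its vectors `v` become `γ v`, which stay nonzero since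
  -- `γ` is invertible.
  refine ⟨l.map fun v => γ.1 *ᵥ v, fun u hu => ?_, ?_, ?_⟩
  · obtain ⟨v, hv, rfl⟩ := List.mem_map.1 hu
    intro h0
    apply hl v hv
    rw [← inv_mulVec_mulVec γ v, h0, Matrix.mulVec_zero]
  · rw [diffs_comp_inv]
    exact support_comp_inv_finite γ hs
  -- This is the defining equation `h * denom l = expSum (diffs l g)` with the field automorphism
  -- `laurentAct γ` applied to both sides.
  · rw [diffs_comp_inv, expSum_comp_inv γ hs, ← e, map_mul, laurentAct_denom]

/-! ### Equivariance of the Solomon–Hu pairing -/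

/-- The slash action transposes its argument before acting on series, so slashing by `γᵀ` acts there
by `γ` itself. -/
theorem transposeGL_transposeGL {n : ℕ} (γ : GL (Fin n) ℚ) :
    transposeGL (transposeGL γ) = γ :=
  Units.ext (Matrix.transpose_transpose _)

theorem conePairing_apply {n : ℕ} (c : coneGroup n) (f : testFun n) :
    conePairing n c f = formalSum (coneMul c.1 f.1) := rfl

/-- Reconciles the two conventions: test functions are acted on through row vectors, while cones and
exponents are moved by `γ` acting on columns. -/
theorem testFunAct_transposeGL_apply {n : ℕ} (γ : GL (Fin n) ℚ) (f : testFun n)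
    (w : Fin n → ℚ) : (testFunAct (transposeGL γ) f).1 w = f.1 (γ.1 *ᵥ w) := by
  change f.1 (w ᵥ* γ.1ᵀ) = _
  rw [Matrix.vecMul_transpose]

/-- If `c'(γ w) = c(w)` for all `w ∈ ℚⁿ`, then `⟨c', f⟩ = γ · ⟨c, γᵀ · f⟩`. -/
theorem conePairing_slash {n : ℕ} (γ : GL (Fin n) ℚ) {c c' : coneGroup n}
    (h : ∀ w : Fin n → ℚ, c'.1 (fun i => ((γ.1 *ᵥ w) i : ℝ)) = c.1 fun i => (w i : ℝ)) :
    conePairing n c' = Dist.slash (conePairing n c) (transposeGL γ) := by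
  ext f
  change conePairing n c' f = laurentAct (transposeGL (transposeGL γ))
    (conePairing n c (testFunAct (transposeGL γ) f))
  -- `formalSum` takes the default value `0` when no value exists, so an actual value `s` is needed
  -- before anything can be transported. Uniqueness of values then identifies the left side with `γ
  -- · s`.
  obtain ⟨s, hs⟩ := exists_isFormalSum c.2 (testFunAct (transposeGL γ) f).2
  rw [transposeGL_transposeGL, conePairing_apply, conePairing_apply, hs.formalSum_eq]
  have := hs.comp_inv γ
  refine IsFormalSum.formalSum_eq ?_
  -- Only the coefficient functions remain to be compared. At `w`, the hypothesis is applied to the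
  -- point `γ⁻¹ w`, and `γ (γ⁻¹ w) = w` restores both `c'(w)` and `f(w)`.
  convert this using 1
  funext w
  simp only [coneMul, ← h, testFunAct_transposeGL_apply, mulVec_inv_mulVec]

/-! ### The Shintani cone function under `GLₙ(ℚ)` -/

/-- Every ordered field induces the usual order on `ℚ`. This lets the sign of `det γ`, which arises
in `ℝ((ε₁)) ⋯ ((εₙ))`, be read off in `ℚ`. -/
theorem sign_ratCast {F : Type*} [Field F] [LinearOrder F] [IsStrictOrderedRing F] (q : ℚ) :
    SignType.sign (q : F) = SignType.sign q := by
  rcases lt_trichotomy q 0 with h | rfl | h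
  · rw [sign_neg h, sign_neg (Rat.cast_lt_zero.2 h)]
  · simp
  · rw [sign_pos h, sign_pos (Rat.cast_pos.2 h)]

/-- An invertible linear map does not change the coefficients in an expansion along the `v j`, so
the positivity condition is the same on both sides; the sign changes by multiplicativity of the
determinant. The `v j` may be dependent, in which case both sides vanish. -/
theorem signedCone_mulVec {n : ℕ} {F : Type*} [Field F] [LinearOrder F] [IsStrictOrderedRing F]
    {A : Matrix (Fin n) (Fin n) F} (hA : IsUnit A) (v : Fin n → Fin n → F) (w : Fin n → F) :
    signedCone (fun j => A *ᵥ v j) (A *ᵥ w) = (SignType.sign A.det : ℤ) * signedCone v w := by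
  classical
  have hM : (Matrix.of fun i j => (A *ᵥ v j) i) = A * Matrix.of fun i j => v j i := by
    ext i j
    simp [Matrix.mul_apply, Matrix.mulVec, dotProduct]
  have hiff : ∀ l : Fin n → F, A *ᵥ w = ∑ j, l j • (A *ᵥ v j) ↔ w = ∑ j, l j • v j := by
    intro l
    simp only [← Matrix.mulVec_smul, ← Matrix.mulVec_sum]
    exact (Matrix.mulVec_injective_of_isUnit hA).eq_iff
  simp only [signedCone, hiff, hM, Matrix.det_mul, sign_mul, mul_ite, mul_zero, SignType.coe_mul]

theorem map_ratCast_mulVec {n : ℕ} {F : Type*} [DivisionRing F] [CharZero F]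
    (A : Matrix (Fin n) (Fin n) ℚ) (w : Fin n → ℚ) :
    A.map (Rat.cast : ℚ → F) *ᵥ (fun i => (w i : F)) = fun i => ((A *ᵥ w) i : F) := by
  funext i
  simp [Matrix.mulVec, dotProduct]

/-- `signedCone_mulVec` over `ℝ((ε₁)) ⋯ ((εₙ))` with the matrix `γ`. Rational points suffice,
because the pairing samples cone functions only on `ℚⁿ`. -/
theorem sigmaSh_mul {n : ℕ} (γ : GL (Fin n) ℚ) (α : Fin n → GL (Fin n) ℚ) (w : Fin n → ℚ) :
    sigmaSh (fun j => γ * α j) (fun i => ((γ.1 *ᵥ w) i : ℝ)) =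
      signGL γ * sigmaSh α fun i => (w i : ℝ) := by
  let f : ℚ →+* EpsField n := Rat.castHom (EpsField n)
  have hdet : (γ.1.map (Rat.cast : ℚ → EpsField n)).det = ((γ.1.det : ℚ) : EpsField n) :=
    (f.map_det γ.1).symm
  -- Invertibility survives base change, since the entrywise cast is a ring homomorphism of matrix
  -- rings.
  have hA : IsUnit (γ.1.map (Rat.cast : ℚ → EpsField n)) := γ.isUnit.map f.mapMatrix
  have key := signedCone_mulVec hA
    (fun j => (α j).1.map (Rat.cast : ℚ → EpsField n) *ᵥ bVec (eps n j))
    (fun i => (w i : EpsField n))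
  rw [hdet, sign_ratCast, map_ratCast_mulVec] at key
  have hmul : ∀ j, ((γ * α j).1.map (Rat.cast : ℚ → EpsField n)) *ᵥ bVec (eps n j) =
      γ.1.map (Rat.cast : ℚ → EpsField n) *ᵥ
        ((α j).1.map (Rat.cast : ℚ → EpsField n) *ᵥ bVec (eps n j)) := by
    intro j
    rw [Matrix.mulVec_mulVec]
    exact congrArg (· *ᵥ bVec (eps n j)) (f.mapMatrix.map_mul γ.1 (α j).1)
  -- A rational coordinate enters the field through `ℝ` and `realToEps`; `map_ratCast` identifies
  -- its image with the direct cast used in `key`.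
  simp only [sigmaSh, map_ratCast, hmul]
  exact key

/-! ### Naive cones under `GLₙ(ℚ)` -/

/-- The same positive coefficients serve for the image point, by linearity; neither invertibility of
the matrix nor independence of the generators plays a role. -/
theorem mem_openCone_mulVec {n : ℕ} {ι : Type} [Fintype ι] (γ : Matrix (Fin n) (Fin n) ℚ)
    {v : ι → Fin n → ℚ} {w : Fin n → ℚ} (hw : (fun i => (w i : ℝ)) ∈ openCone v) :
    (fun i => ((γ *ᵥ w) i : ℝ)) ∈ openCone fun j => γ *ᵥ v j := by
  obtain ⟨t, ht, hx⟩ := hw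
  refine ⟨t, ht, fun i => ?_⟩
  simp only [Matrix.mulVec, dotProduct, Rat.cast_sum, Rat.cast_mul, hx, Finset.mul_sum]
  rw [Finset.sum_comm]
  exact Finset.sum_congr rfl fun j _ => Finset.sum_congr rfl fun k _ => by ring

theorem mem_openCone_mulVec_iff {n : ℕ} {ι : Type} [Fintype ι] (γ : GL (Fin n) ℚ)
    (v : ι → Fin n → ℚ) (w : Fin n → ℚ) :
    (fun i => ((γ.1 *ᵥ w) i : ℝ)) ∈ openCone (fun j => γ.1 *ᵥ v j) ↔
      (fun i => (w i : ℝ)) ∈ openCone v := by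
  refine ⟨fun h => ?_, mem_openCone_mulVec γ.1⟩
  -- The converse is the forward implication for `γ⁻¹`, applied to the image cone.
  simpa only [inv_mulVec_mulVec] using mem_openCone_mulVec (γ⁻¹).1 h

/-- The generator `e₁ αⱼᵀ` is the first column `αⱼ e₁`, so replacing `αⱼ` by `γ αⱼ` multiplies each
generator by `γ` on the left. -/
theorem naiveCone_mul {n : ℕ} [NeZero n] (γ : GL (Fin n) ℚ) (α : Fin n → GL (Fin n) ℚ)
    (w : Fin n → ℚ) :
    (fun i => ((γ.1 *ᵥ w) i : ℝ)) ∈ naiveCone (fun j => γ * α j) ↔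
      (fun i => (w i : ℝ)) ∈ naiveCone α := by
  rw [naiveCone, naiveCone,
    ← mem_openCone_mulVec_iff γ fun j => (Pi.single 0 1 : Fin n → ℚ) ᵥ* (α j).1ᵀ]
  simp only [Matrix.vecMul_transpose, Matrix.mulVec_mulVec, Units.val_mul]

/-! ### Transformation laws in `Dist(ℚⁿ)` -/

theorem PhiShRat_mul {n : ℕ} [NeZero n] (γ : GL (Fin n) ℚ) (α : Fin n → GL (Fin n) ℚ) :
    PhiShRat (fun j => γ * α j) = signGL γ • (PhiShRat α).slash (transposeGL γ) := by
  -- The sign is absorbed into the cone function `c`, so that `c'(γ w) = c(w)` holds exactly.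
  -- Additivity of the pairing in its first argument then extracts it again.
  have h := conePairing_slash γ (c := signGL γ • ⟨sigmaSh α, sigmaSh_mem α⟩)
    (c' := ⟨sigmaSh fun j => γ * α j, sigmaSh_mem _⟩) fun w =>
      (sigmaSh_mul γ α w).trans (smul_eq_mul _ _).symm
  rw [map_zsmul] at h
  -- `h` concerns `conePairing` and the goal concerns `solomonHu`; they agree definitionally, a lift
  -- to a quotient being evaluated on a class `mk c`. What is left is to move the integer factor
  -- past the automorphism of the Laurent field.
  refine h.trans ?_
  ext f
  exact map_zsmul (laurentAct (transposeGL (transposeGL γ))) _ _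

theorem PhiNSh_mul {n : ℕ} [NeZero n] (γ : GL (Fin n) ℚ) (α : Fin n → GL (Fin n) ℚ) :
    PhiNSh (fun j => γ * α j) = (PhiNSh α).slash (transposeGL γ) := by
  classical
  -- Naming the representatives reduces the statement about classes modulo constants to
  -- `conePairing`. A characteristic function carries no orientation, hence no sign.
  refine conePairing_slash γ (c := ⟨(naiveCone α).indicator 1, openCone_mem_coneGroup _⟩)
    (c' := ⟨(naiveCone fun j => γ * α j).indicator 1, openCone_mem_coneGroup _⟩) fun w => ?_
  simp only [Set.indicator_apply, naiveCone_mul, Pi.one_apply]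

/-! ### Descent to `Dist(𝔸_fⁿ ∖ {0})` -/

theorem ratToAdele_vecMul {n : ℕ} (γ : GL (Fin n) ℚ) (w : Fin n → ℚ) :
    ratToAdele (w ᵥ* γ.1) = ratToAdele w ᵥ* adelicMat γ := by
  funext j
  simp [ratToAdele, adelicMat, Matrix.vecMul, dotProduct]

/-- Right multiplication by `γ` fixes `0` and permutes the nonzero vectors, so it commutes with
extension by zero. -/
theorem extendZero_adelicTestFunAct {n : ℕ} (γ : GL (Fin n) ℚ) (f : adelicTestFun n)
    (x : Fin n → AdeleFin) :
    extendZero (adelicTestFunAct γ f).1 x = extendZero f.1 (x ᵥ* adelicMat γ) := by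
  have hzero : ∀ g : {x : Fin n → AdeleFin // x ≠ 0} → ℤ, extendZero g 0 = 0 := fun g =>
    Function.extend_apply' _ _ _ fun ⟨y, hy⟩ => y.2 hy
  have hne : ∀ (g : {x : Fin n → AdeleFin // x ≠ 0} → ℤ) y, extendZero g y.1 = g y := fun g y =>
    Subtype.val_injective.extend_apply g 0 y
  by_cases hx : x = 0
  · rw [hx, Matrix.zero_vecMul, hzero, hzero]
  · exact (hne _ ⟨x, hx⟩).trans (hne f.1 (adelicHomeo γ ⟨x, hx⟩)).symm

theorem adelicRes_adelicTestFunAct {n : ℕ} (γ : GL (Fin n) ℚ) (f : adelicTestFun n) :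
    adelicRes n (adelicTestFunAct γ f) = testFunAct γ (adelicRes n f) := by
  ext w
  change extendZero (adelicTestFunAct γ f).1 (ratToAdele w) = extendZero f.1 (ratToAdele _)
  rw [extendZero_adelicTestFunAct, ratToAdele_vecMul]

/-- Pulling distributions back along the restriction map is equivariant because restriction itself
is; the action on the Laurent side is the same in both cases. The adelic law is thereby inherited
from the rational one. -/
theorem slash_comp_adelicRes {n : ℕ} (μ : Dist n) (γ : GL (Fin n) ℚ) :
    AdelicDist.slash (μ.comp (adelicRes n)) γ = (μ.slash γ).comp (adelicRes n) := by
  ext f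
  exact congrArg (fun g => laurentAct (transposeGL γ) (μ g)) (adelicRes_adelicTestFunAct γ f)

theorem PhiSh_mul {n : ℕ} [NeZero n] (γ : GL (Fin n) ℚ) (α : Fin n → GL (Fin n) ℚ) :
    PhiSh (fun j => γ * α j) = signGL γ • (PhiSh α).slash (transposeGL γ) := by
  rw [PhiSh, PhiSh, PhiShRat_mul, slash_comp_adelicRes]
  -- Integer multiples of additive maps are pointwise, so the sign passes through composition with
  -- `adelicRes n` by definition.
  rfl

end ShintaniCocycle

theorem mainTheorem4 (n : ℕ) [NeZero n] (γ : Matrix.GeneralLinearGroup (Fin n) ℚ)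
    (γs : Fin n → Matrix.GeneralLinearGroup (Fin n) ℚ) :
    ShintaniCocycle.PhiSh (fun j => γ * γs j) =
        ShintaniCocycle.signGL γ •
          (ShintaniCocycle.PhiSh γs).slash (ShintaniCocycle.transposeGL γ) ∧
      ShintaniCocycle.PhiShRat (fun j => γ * γs j) =
        ShintaniCocycle.signGL γ •
          (ShintaniCocycle.PhiShRat γs).slash (ShintaniCocycle.transposeGL γ) ∧
      ShintaniCocycle.PhiNSh (fun j => γ * γs j) =
        (ShintaniCocycle.PhiNSh γs).slash (ShintaniCocycle.transposeGL γ) :=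
  ⟨ShintaniCocycle.PhiSh_mul γ γs, ShintaniCocycle.PhiShRat_mul γ γs,
    ShintaniCocycle.PhiNSh_mul γ γs⟩
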